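/- Let $\mathbb{T}^2=(\mathbb{R}/\mathbb{Z})^2$ and write $\hat f(m,n)=\langle f, e^{-2\pi i(mx_1+nx_2)}\rangle$, $(m,n)\in\mathbb{Z}^2$, for the Fourier coefficients of a distribution $f\in C^\infty(\mathbb{T}^2)'$. Call $f$ \emph{proper} if $\hat f(m,n)=0$ whenever $m=0$ or $n=0$. For $\alpha,\beta\in\mathbb{R}$ let $W_2^{\alpha,\beta}(\mathbb{T}^2)$ be the space of distributions $f$ on $\mathbb{T}^2$ with $$\|f\|_{W_2^{\alpha,\beta}(\mathbb{T}^2)}=\Big(\sum_{(m,n)\in\mathbb{Z}^2}(1+m^2)^{\alpha}(1+n^2)^{\beta}|\hat f(m,n)|^2\Big)^{1/2}<\infty .$$ **Theorem.** Let $k,l,N\ge 1$ be integers such that $k$ is odd or $l$ is odd (or both). There is a constant $C$, depending only on $k$, $l$ and $N$, such that the following holds. Let $\varphi_1,\dots,\varphi_N$ be proper distributions on $\mathbb{T}^2$ and let $\mu_0,\dots,\mu_N$ be finite complex Borel measures on $\mathbb{T}^2$ such that, in the sense of distributions, $$-\partial_1^k\varphi_1=\mu_0;\qquad \partial_2^l\varphi_j-\partial_1^k\varphi_{j+1}=\mu_j,\quad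 j=1,\dots,N-1;\qquad \partial_2^l\varphi_N=\mu_N .$$ Then $\varphi_1,\dots,\varphi_N$ belong to $W_2^{\frac{k-1}{2},\frac{l-1}{2}}(\mathbb{T}^2)$, and $$\sum_{j=1}^N\|\varphi_j\|_{W_2^{\frac{k-1}{2},\frac{l-1}{2}}(\mathbb{T}^2)}\le C\sum_{j=0}^N\|\mu_j\|,$$ where $\|\mu\|$ denotes the total variation of $\mu$. -/

import Mathlib

open MeasureTheory
open scoped ContDiff ENNReal

noncomputable section

namespace Torus

/-- The two-dimensional torus `(ℝ / ℤ)²`. -/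
abbrev T2 : Type := UnitAddTorus (Fin 2)

/-- The quotient map `ℝ² → 𝕋²`. -/
def proj (x : Fin 2 → ℝ) : T2 := fun i => (x i : UnitAddCircle)

/-- The periodic function on `ℝ²` determined by a function on the torus. -/
def lift (f : T2 → ℂ) : (Fin 2 → ℝ) → ℂ := fun x => f (proj x)

/-- The partial derivative in the `i`-th coordinate of a function on the torus. -/
def pderiv (i : Fin 2) (f : T2 → ℂ) : T2 → ℂ :=
  fun z => deriv (fun t : ℝ => f (z + Pi.single i (t : UnitAddCircle))) 0

/-- The vector space of infinitely differentiable complex functions on the torus. -/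
def smoothSubmodule : Submodule ℂ (T2 → ℂ) where
  carrier := {f | ContDiff ℝ ∞ (lift f)}
  add_mem' := fun {f g} (hf : ContDiff ℝ ∞ (lift f)) (hg : ContDiff ℝ ∞ (lift g)) =>
    show ContDiff ℝ ∞ (fun x => lift f x + lift g x) from hf.add hg
  zero_mem' := show ContDiff ℝ ∞ (fun _ => (0 : ℂ)) from contDiff_const
  smul_mem' := fun c f (hf : ContDiff ℝ ∞ (lift f)) =>
    show ContDiff ℝ ∞ (fun x => c • lift f x) from hf.const_smul c

/-- The space `C^∞(𝕋²)`. It is a type of its own, so that it can carry its standard topology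
instead of the topology of pointwise convergence. -/
def TestFunction : Type := smoothSubmodule

namespace TestFunction

instance : AddCommGroup TestFunction := inferInstanceAs (AddCommGroup smoothSubmodule)
instance : Module ℂ TestFunction := inferInstanceAs (Module ℂ smoothSubmodule)
instance : CoeFun TestFunction (fun _ => T2 → ℂ) := ⟨fun f => f.1⟩

theorem smooth (f : TestFunction) : ContDiff ℝ ∞ (lift f) := f.2

@[ext]
theorem ext {f g : TestFunction} (h : ∀ z, f z = g z) : f = g := Subtype.ext (funext h)

end TestFunction

theorem proj_surjective : Function.Surjective proj := by
  intro z
  choose x hx using fun i => QuotientAddGroup.mk_surjective (z i)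
  exact ⟨x, funext hx⟩

theorem proj_isOpenQuotientMap : IsOpenQuotientMap proj :=
  IsOpenQuotientMap.piMap (fun _ => QuotientAddGroup.isOpenQuotientMap_mk)

theorem proj_add_single (x : Fin 2 → ℝ) (i : Fin 2) (t : ℝ) :
    proj (x + t • Pi.single i 1) = proj x + Pi.single i (t : UnitAddCircle) := by
  funext j
  by_cases h : j = i
  · subst h; simp [proj]
  · simp [proj, h]

theorem lift_pderiv (i : Fin 2) {f : T2 → ℂ} (hf : ContDiff ℝ ∞ (lift f)) :
    lift (pderiv i f) = fun x => fderiv ℝ (lift f) x (Pi.single i 1) := by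
  funext x
  have hd : DifferentiableAt ℝ (lift f) x := hf.differentiable (by simp) x
  rw [← hd.lineDeriv_eq_fderiv]
  simp only [lift, pderiv, lineDeriv, proj_add_single]

theorem contDiff_lift_pderiv (i : Fin 2) {f : T2 → ℂ} (hf : ContDiff ℝ ∞ (lift f)) :
    ContDiff ℝ ∞ (lift (pderiv i f)) := by
  rw [lift_pderiv i hf]
  exact (hf.fderiv_right (m := ∞) (by simp)).clm_apply contDiff_const

theorem lift_injective {f g : T2 → ℂ} (h : lift f = lift g) : f = g := by
  funext z
  obtain ⟨x, rfl⟩ := proj_surjective z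
  exact congrFun h x

namespace TestFunction

/-- A smooth function on the torus as a continuous function. -/
def toContinuousMap : TestFunction →ₗ[ℂ] C(T2, ℂ) where
  toFun f := ⟨f, proj_isOpenQuotientMap.isQuotientMap.continuous_iff.2 f.smooth.continuous⟩
  map_add' _ _ := rfl
  map_smul' _ _ := rfl

/-- The partial derivative as a linear operator on `C^∞(𝕋²)`. -/
def partialₗ (i : Fin 2) : TestFunction →ₗ[ℂ] TestFunction where
  toFun f := ⟨pderiv i f, contDiff_lift_pderiv i f.smooth⟩
  map_add' f g := by
    apply Subtype.ext
    apply lift_injective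
    have hf : Differentiable ℝ (lift f) := f.smooth.differentiable (by simp)
    have hg : Differentiable ℝ (lift g) := g.smooth.differentiable (by simp)
    have h1 := lift_pderiv i (f + g).smooth
    have h2 := lift_pderiv i f.smooth
    have h3 := lift_pderiv i g.smooth
    have h4 : lift (f + g : TestFunction) = lift f + lift g := rfl
    change lift (pderiv i (f + g : TestFunction)) = lift (pderiv i f) + lift (pderiv i g)
    rw [h1, h2, h3, h4]
    funext x
    simp [fderiv_add (hf x) (hg x)]
  map_smul' c f := by
    apply Subtype.ext
    apply lift_injective
    have hf : Differentiable ℝ (lift f) := f.smooth.differentiable (by simp)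
    have h1 := lift_pderiv i (c • f).smooth
    have h2 := lift_pderiv i f.smooth
    have h4 : lift (c • f : TestFunction) = c • lift f := rfl
    change lift (pderiv i (c • f : TestFunction)) = c • lift (pderiv i f)
    rw [h1, h2, h4]
    funext x
    simp [fderiv_const_smul (hf x) c]

theorem partialₗ_comm (f : TestFunction) (i j : Fin 2) :
    partialₗ i (partialₗ j f) = partialₗ j (partialₗ i f) := by
  apply Subtype.ext
  apply lift_injective
  have key : ∀ i j : Fin 2, lift (pderiv i (pderiv j f)) =
      fun x => fderiv ℝ (fderiv ℝ (lift f)) x (Pi.single i 1) (Pi.single j 1) := by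
    intro i j
    rw [lift_pderiv i (contDiff_lift_pderiv j f.smooth), lift_pderiv j f.smooth]
    funext x
    have hd : DifferentiableAt ℝ (fderiv ℝ (lift f)) x :=
      (f.smooth.fderiv_right (m := ∞) (by simp)).differentiable (by simp) x
    rw [fderiv_clm_apply hd (differentiableAt_const _)]
    simp
  change lift (pderiv i (pderiv j f)) = lift (pderiv j (pderiv i f))
  rw [key, key]
  funext x
  exact (f.smooth.contDiffAt.isSymmSndFDerivAt
    (by simpa using! (WithTop.coe_le_coe.2 (le_top : (2 : ℕ∞) ≤ ⊤)))) _ _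

/-- The seminorms `f ↦ ‖∂₁ᵃ ∂₂ᵇ f‖_∞`. -/
def seminorm : SeminormFamily ℂ TestFunction (ℕ × ℕ) := fun ab =>
  (normSeminorm ℂ C(T2, ℂ)).comp
    (toContinuousMap ∘ₗ (partialₗ 0 ^ ab.1) ∘ₗ (partialₗ 1 ^ ab.2))

/-- The standard topology of `C^∞(𝕋²)`: uniform convergence of all derivatives. -/
instance : TopologicalSpace TestFunction := seminorm.moduleFilterBasis.topology

theorem withSeminorms : WithSeminorms seminorm := ⟨rfl⟩

instance : IsTopologicalAddGroup TestFunction := withSeminorms.topologicalAddGroup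
instance : ContinuousSMul ℂ TestFunction := withSeminorms.continuousSMul

theorem continuous_partialₗ (i : Fin 2) : Continuous (partialₗ i) := by
  have hcomm : Commute (partialₗ 0 : Module.End ℂ TestFunction) (partialₗ 1) :=
    LinearMap.ext fun f => partialₗ_comm f 0 1
  refine WithSeminorms.continuous_of_isBounded withSeminorms withSeminorms _
    (Seminorm.IsBounded.of_real fun ab => ?_)
  match i with
  | 0 =>
    refine ⟨{(ab.1 + 1, ab.2)}, 1, fun f => le_of_eq ?_⟩
    have h := congrArg (fun T : Module.End ℂ TestFunction => T f)
      (hcomm.pow_right ab.2).eq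
    simp only [Module.End.mul_apply] at h
    simp [seminorm, pow_succ, h]
  | 1 =>
    refine ⟨{(ab.1, ab.2 + 1)}, 1, fun f => le_of_eq ?_⟩
    simp [seminorm, pow_succ]

/-- The partial derivative as a continuous linear operator on `C^∞(𝕋²)`. -/
def partialL (i : Fin 2) : TestFunction →L[ℂ] TestFunction :=
  ⟨partialₗ i, continuous_partialₗ i⟩

/-- The exponential `x ↦ exp (2πi (n₁ x₁ + n₂ x₂))`. -/
def character (n : Fin 2 → ℤ) : TestFunction :=
  ⟨fun z => UnitAddTorus.mFourier n z, by
    change ContDiff ℝ ∞ (fun x => UnitAddTorus.mFourier n (proj x))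
    simp only [UnitAddTorus.mFourier, ContinuousMap.coe_mk, proj, fourier_coe_apply]
    refine contDiff_prod fun i _ => Complex.contDiff_exp.comp ?_
    refine ContDiff.div_const (contDiff_const.mul ?_) _
    exact Complex.ofRealCLM.contDiff.comp (contDiff_apply ℝ ℝ i)⟩

end TestFunction

/-- Distributions on the torus: continuous linear functionals on `C^∞(𝕋²)`. -/
abbrev Distr : Type := TestFunction →L[ℂ] ℂ

namespace Distr

/-- The partial derivative of a distribution, `⟨∂ᵢ u, f⟩ = - ⟨u, ∂ᵢ f⟩`. -/
def pd (i : Fin 2) (u : Distr) : Distr := -(u.comp (TestFunction.partialL i))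

/-- The Fourier coefficients of a distribution. -/
def fourierCoeff (u : Distr) (n : Fin 2 → ℤ) : ℂ := u (TestFunction.character (-n))

/-- A distribution is proper if its Fourier coefficients vanish on the coordinate axes. -/
def IsProper (u : Distr) : Prop := ∀ n : Fin 2 → ℤ, n 0 = 0 ∨ n 1 = 0 → fourierCoeff u n = 0

/-- The weighted Fourier coefficients `(1 + m²)^(α/2) (1 + n²)^(β/2) û(m, n)`. -/
def sobolevCoeff (α β : ℝ) (u : Distr) (n : Fin 2 → ℤ) : ℂ :=
  (((1 + (n 0 : ℝ) ^ 2) ^ (α / 2) * (1 + (n 1 : ℝ) ^ 2) ^ (β / 2) : ℝ) : ℂ) * fourierCoeff u n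

/-- Membership in the anisotropic Sobolev space `W_2^{α,β}(𝕋²)`. -/
def MemSobolev (α β : ℝ) (u : Distr) : Prop := Memℓp (sobolevCoeff α β u) 2

/-- The norm of `W_2^{α,β}(𝕋²)` (meaningful for members of this space). -/
def sobolevNorm (α β : ℝ) (u : Distr) : ℝ := Real.sqrt (∑' n, ‖sobolevCoeff α β u n‖ ^ 2)

end Distr

/-- A complex measure has finite total variation. -/
instance isFiniteMeasure_variation (μ : ComplexMeasure T2) : IsFiniteMeasure μ.variation := by
  refine isFiniteMeasure_of_le
    ((ComplexMeasure.re μ).totalVariation + (ComplexMeasure.im μ).totalVariation)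
    (VectorMeasure.variation_le_of_forall_enorm_le fun E _ => ?_)
  rw [Measure.add_apply]
  refine le_trans ?_ (add_le_add (SignedMeasure.enorm_le_totalVariation _ E)
    (SignedMeasure.enorm_le_totalVariation _ E))
  rw [ComplexMeasure.re_apply, ComplexMeasure.im_apply]
  have h : μ E = ((μ E).re : ℂ) + ((μ E).im : ℂ) * Complex.I := (Complex.re_add_im _).symm
  calc ‖μ E‖ₑ = ‖((μ E).re : ℂ) + ((μ E).im : ℂ) * Complex.I‖ₑ := by rw [← h]
    _ ≤ ‖((μ E).re : ℂ)‖ₑ + ‖((μ E).im : ℂ) * Complex.I‖ₑ := enorm_add_le _ _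
    _ = ‖(μ E).re‖ₑ + ‖(μ E).im‖ₑ := by simp [← ofReal_norm]
    _ ≤ _ := le_of_eq rfl

/-- The norm of a (finite, complex, Borel) measure: its total variation. -/
def measureNorm (μ : ComplexMeasure T2) : ℝ := (μ.variation Set.univ).toReal

theorem integrable_testFunction (μ : ComplexMeasure T2) (f : TestFunction) :
    μ.Integrable f :=
  (TestFunction.toContinuousMap f).continuous.integrable_of_hasCompactSupport
    (HasCompactSupport.of_compactSpace _)

/-- Integration against a complex measure as a linear functional on `C^∞(𝕋²)`. -/
def integralₗ (μ : ComplexMeasure T2) : TestFunction →ₗ[ℂ] ℂ where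
  toFun f := μ.integral f (ContinuousLinearMap.mul ℝ ℂ)
  map_add' f g :=
    VectorMeasure.integral_add (integrable_testFunction μ f) (integrable_testFunction μ g)
  map_smul' c f := by
    refine setToFun_smul (𝕜 := ℂ) _ (fun c s x => ?_) c (f : T2 → ℂ)
    change c • x * μ s = c • (x * μ s)
    rw [smul_mul_assoc]

theorem continuous_integralₗ (μ : ComplexMeasure T2) : Continuous (integralₗ μ) := by
  refine TestFunction.withSeminorms.continuous_normedSpace_rng ℂ _ ⟨{(0, 0)},
    ⟨‖ContinuousLinearMap.mul ℝ ℂ‖ * μ.variation.real Set.univ, by positivity⟩, fun f => ?_⟩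
  have h := VectorMeasure.norm_integral_le_of_norm_le_const (μ := μ) (f := (f : T2 → ℂ))
    (B := ContinuousLinearMap.mul ℝ ℂ) (C := ‖TestFunction.toContinuousMap f‖)
    (Filter.Eventually.of_forall fun x =>
      (TestFunction.toContinuousMap f).norm_coe_le_norm x)
  have h0 : TestFunction.seminorm (0, 0) f = ‖TestFunction.toContinuousMap f‖ := by
    simp [TestFunction.seminorm]
  rw [Finset.sup_singleton]
  change ‖μ.integral f (ContinuousLinearMap.mul ℝ ℂ)‖ ≤
    (‖ContinuousLinearMap.mul ℝ ℂ‖ * μ.variation.real Set.univ) * TestFunction.seminorm (0, 0) f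
  rw [h0]
  linarith

/-- A complex measure as a distribution, `f ↦ ∫ f dμ`. -/
def ofMeasure (μ : ComplexMeasure T2) : Distr := ⟨integralₗ μ, continuous_integralₗ μ⟩

end Torus

end

noncomputable section

namespace Torus

open Filter Topology Finset UnitAddTorus

open scoped ComplexConjugate

/-! The system is a polynomial identity in disguise. With `φ_τ = Σ τ^r φ_{r+1}` and `μ_τ = Σ τ^j
μ_j`, the equations telescope to `(τ ∂₂ˡ - ∂₁ᵏ) φ_τ = μ_τ` for every complex `τ`
(`sum_pow_mul_telescope`). For suitable `τ` the symbol is, up to a constant, `mᵏ - ip nˡ` with `p`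
real and nonzero, which vanishes only at the origin.

Take two such parameters, `τ` leading to `p` and `σ` leading to `-q`. Off the axes, `|m|ᵏ⁻¹|n|ˡ⁻¹
φ̂_τ conj(φ̂_σ)` is a constant times `symbol k l p q m n * μ̂_τ * conj(μ̂_σ)`. If that symbol is the
Fourier transform of a bounded kernel, its sum against two measures is at most the supremum of the
kernel times the two total variations (`norm_tsum_mul_conj_le`).

The kernel is bounded because of a cancellation. For `k` odd, `|m|ᵏ⁻¹ = mᵏ⁻¹`, and rescaling `m` by
`L = |n|^(l/k)` turns the symbol into `1/(|n| L)` times `t^(k-1) / ((tᵏ - ip)(tᵏ - iq))` at `t =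
m/L`, up to a common sign of `p` and `q`. The substitution `u = tᵏ` shows that this profile has
integral zero when `p` and `q` have the same sign: both poles lie in one half-plane. Hence the sum
over `m` against `z^m` is small both for `z` near 1 (zero mean) and for `z` far from 1 (summation by
parts), as quantified in `IsProfile.norm_tsum_zpow_le`. The resulting bounds are summable over `n`,
uniformly in `z` (`exists_kernel_bound`). If only `l` is odd, the two variables exchange roles.

Finally, `N` values of `p` and `N` further values of `q` give two invertible Vandermonde systems, so
`|φ̂_j|²` is a fixed combination of the products `φ̂_τ conj(φ̂_σ)`, and the weighted sums of
`|φ̂_j|²` are bounded (`exists_weighted_sum_bound`). -/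

/-! ### Dyadic-type sums bounded uniformly by an arctangent -/

/-- The function `v / (1 + v²)`. -/
def bump (v : ℝ) : ℝ := v / (1 + v ^ 2)

theorem bump_nonneg {v : ℝ} (hv : 0 ≤ v) : 0 ≤ bump v := by unfold bump; positivity

theorem bump_le_mul_bump {v w c : ℝ} (hv : 0 ≤ v) (hvw : v ≤ w) (hc : 1 ≤ c)
    (hw : w ≤ c * v) : bump v ≤ c ^ 2 * bump w := by
  unfold bump
  rw [← mul_div_assoc, div_le_div_iff₀ (by positivity) (by positivity)]
  have h1 : w ^ 2 ≤ c ^ 2 * v ^ 2 := by rw [← mul_pow]; gcongr; linarith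
  have h2 : 1 + w ^ 2 ≤ c ^ 2 * (1 + v ^ 2) := by nlinarith
  calc v * (1 + w ^ 2) ≤ w * (c ^ 2 * (1 + v ^ 2)) := by gcongr; linarith
    _ = _ := by ring

/-- The derivative of `arctan (b x^δ)` is `δ/x * bump (b x^δ)`. The mean value theorem on `[t, t +
1]` gives this quantity at some `ξ`; moving back to `t` costs a factor 2 for `1/x` and `(2^δ)²` for
`bump`, as `ξ ≤ 2t`. -/
theorem bump_le_sub_arctan {δ b t : ℝ} (hδ : 0 < δ) (hb : 0 ≤ b) (ht : 1 ≤ t) :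
    1 / t * bump (b * t ^ δ) ≤ 2 * (2 ^ δ) ^ 2 / δ *
      (Real.arctan (b * (t + 1) ^ δ) - Real.arctan (b * t ^ δ)) := by
  have hderiv : ∀ x ∈ Set.Ioo t (t + 1), HasDerivAt (fun x => Real.arctan (b * x ^ δ))
      (δ * (1 / x * bump (b * x ^ δ))) x := by
    intro x hx
    have hx0 : 0 < x := by linarith [hx.1]
    convert! ((Real.hasDerivAt_rpow_const (p := δ) (Or.inl hx0.ne')).const_mul b).arctan using 1
    rw [Real.rpow_sub_one hx0.ne']
    unfold bump
    ring
  obtain ⟨ξ, hξ, h⟩ := exists_hasDerivAt_eq_slope (fun x => Real.arctan (b * x ^ δ)) _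
    (by linarith : t < t + 1)
    (Real.continuous_arctan.comp (continuous_const.mul
      (Real.continuous_rpow_const hδ.le))).continuousOn hderiv
  have hξ0 : 0 < ξ := by linarith [hξ.1]
  have ht0 : 0 < t := by linarith
  rw [add_sub_cancel_left, div_one] at h
  rw [← h]
  have h1 : bump (b * t ^ δ) ≤ (2 ^ δ) ^ 2 * bump (b * ξ ^ δ) := by
    refine bump_le_mul_bump (by positivity) ?_ (Real.one_le_rpow (by norm_num) hδ.le) ?_
    · gcongr; exact hξ.1.le
    · calc b * ξ ^ δ ≤ b * (2 * t) ^ δ := by gcongr; linarith [hξ.2]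
        _ = _ := by rw [Real.mul_rpow (by norm_num) ht0.le]; ring
  have h2 : 1 / t ≤ 2 * (1 / ξ) := by
    rw [mul_one_div, div_le_div_iff₀ ht0 hξ0]; linarith [hξ.2]
  have h3 := bump_nonneg (v := b * ξ ^ δ) (by positivity)
  calc 1 / t * bump (b * t ^ δ) ≤ (2 * (1 / ξ)) * ((2 ^ δ) ^ 2 * bump (b * ξ ^ δ)) := by
        gcongr
        exact bump_nonneg (by positivity)
    _ = _ := by field_simp

/-- The arctangent differences telescope to at most `π/2`. The uniformity in `b` is the point: later
`b` is `√‖z - 1‖`, and the kernel must be bounded uniformly in `z`. -/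
theorem exists_sum_bump_le {δ : ℝ} (hδ : 0 < δ) : ∃ C : ℝ, 0 ≤ C ∧ ∀ b : ℝ, 0 ≤ b → ∀ N : ℕ,
    ∑ n ∈ range N, 1 / ((n : ℝ) + 1) * bump (b * ((n : ℝ) + 1) ^ δ) ≤ C := by
  refine ⟨2 * (2 ^ δ) ^ 2 / δ * (Real.pi / 2), by positivity, fun b hb N => ?_⟩
  have h : ∀ n ∈ range N, 1 / ((n : ℝ) + 1) * bump (b * ((n : ℝ) + 1) ^ δ) ≤
      2 * (2 ^ δ) ^ 2 / δ * ((fun n : ℕ => Real.arctan (b * ((n : ℝ) + 1) ^ δ)) (n + 1) -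
        (fun n : ℕ => Real.arctan (b * ((n : ℝ) + 1) ^ δ)) n) := by
    intro n _
    push_cast
    exact bump_le_sub_arctan hδ hb (by linarith [n.cast_nonneg (α := ℝ)])
  refine (sum_le_sum h).trans ?_
  rw [← mul_sum, sum_range_sub (fun n : ℕ => Real.arctan (b * ((n : ℝ) + 1) ^ δ))]
  gcongr
  have h1 := Real.arctan_lt_pi_div_two (b * ((N : ℝ) + 1) ^ δ)
  have h2 : 0 ≤ Real.arctan (b * (((0 : ℕ) : ℝ) + 1) ^ δ) :=
    Real.arctan_nonneg.2 (by positivity)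
  exact (sub_le_self _ h2).trans h1.le

/-! ### Telescoping over the integers and powers of unimodular numbers -/

/-- A telescoping sum over the integers. -/
theorem tsum_int_sub {E : Type*} [NormedAddCommGroup E] [CompleteSpace E] {u : ℤ → E} {a b : E}
    (ha : Tendsto u atTop (𝓝 a)) (hb : Tendsto u atBot (𝓝 b))
    (hs : Summable fun m => u (m + 1) - u m) : ∑' m, (u (m + 1) - u m) = a - b := by
  have h1 : Tendsto (fun n : ℕ => u n) atTop (𝓝 a) := ha.comp tendsto_natCast_atTop_atTop
  have h2 : Tendsto (fun n : ℕ => u (-(n : ℤ))) atTop (𝓝 b) :=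
    hb.comp (tendsto_neg_atTop_atBot.comp tendsto_natCast_atTop_atTop)
  have s1 : Summable fun n : ℕ => u ((n : ℤ) + 1) - u n :=
    hs.comp_injective Nat.cast_injective
  have s2 : Summable fun n : ℕ => u (-((n : ℤ) + 1) + 1) - u (-((n : ℤ) + 1)) :=
    hs.comp_injective (i := fun n : ℕ => -((n : ℤ) + 1)) (fun x y h => by simpa using h)
  rw [tsum_of_nat_of_neg_add_one (f := fun m => u (m + 1) - u m) s1 s2]
  have e1 : ∑' n : ℕ, (u ((n : ℤ) + 1) - u n) = a - u 0 := by
    refine tendsto_nhds_unique s1.hasSum.tendsto_sum_nat ?_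
    refine (h1.sub_const (u 0)).congr fun n => ?_
    have := sum_range_sub (fun n : ℕ => u (n : ℤ)) n
    push_cast at this
    exact this.symm
  have e2 : ∑' n : ℕ, (u (-((n : ℤ) + 1) + 1) - u (-((n : ℤ) + 1))) = u 0 - b := by
    refine tendsto_nhds_unique s2.hasSum.tendsto_sum_nat ?_
    refine (h2.const_sub (u 0)).congr fun n => ?_
    have := sum_range_sub' (fun n : ℕ => u (-(n : ℤ))) n
    push_cast at this
    rw [neg_zero] at this
    rw [← this]
    exact sum_congr rfl fun i _ => by congr 2; ring
  rw [e1, e2]; abel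

theorem summable_int_of_monotone {u : ℝ → ℝ} (hu : Monotone u) {A : ℝ} (hA : ∀ t, |u t| ≤ A)
    {L : ℝ} (hL : 0 < L) :
    Summable (fun m : ℤ => u ((m + 1) / L) - u (m / L)) := by
  have hn : ∀ m : ℤ, 0 ≤ u ((m + 1) / L) - u (m / L) := fun m =>
    sub_nonneg.2 (hu (by gcongr; linarith))
  have hbd : ∀ x y, u x - u y ≤ 2 * A := fun x y => by
    have h1 := le_of_abs_le (hA x)
    have h2 := neg_le_of_abs_le (hA y)
    linarith
  apply Summable.of_nat_of_neg_add_one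
  · refine summable_of_sum_range_le (c := 2 * A) (fun n => hn n) fun n => ?_
    have := sum_range_sub (fun n : ℕ => u (n / L)) n
    push_cast at this ⊢
    rw [this]
    exact hbd _ _
  · refine summable_of_sum_range_le (c := 2 * A) (fun n => hn _) fun n => ?_
    have := sum_range_sub' (fun n : ℕ => u (-(n : ℝ) / L)) n
    refine le_trans (le_of_eq ?_) (hbd (-((0 : ℕ) : ℝ) / L) (-(n : ℝ) / L))
    rw [← this]
    refine sum_congr rfl fun i _ => ?_
    push_cast
    congr 3
    ring

theorem tendsto_intCast_div_atTop {L : ℝ} (hL : 0 < L) :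
    Tendsto (fun m : ℤ => (m : ℝ) / L) atTop atTop :=
  tendsto_intCast_atTop_atTop.atTop_div_const hL

theorem tendsto_intCast_div_atBot {L : ℝ} (hL : 0 < L) :
    Tendsto (fun m : ℤ => (m : ℝ) / L) atBot atBot :=
  (tendsto_intCast_atBot_iff.2 tendsto_id).atBot_div_const hL

theorem summable_arctan {L : ℝ} (hL : 0 < L) :
    Summable (fun m : ℤ => Real.arctan ((m + 1) / L) - Real.arctan (m / L)) :=
  summable_int_of_monotone Real.arctan_strictMono.monotone (A := Real.pi / 2)
    (fun t => abs_le.2 ⟨(Real.neg_pi_div_two_lt_arctan t).le, (Real.arctan_lt_pi_div_two t).le⟩) hL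

theorem tsum_arctan {L : ℝ} (hL : 0 < L) :
    ∑' m : ℤ, (Real.arctan ((m + 1) / L) - Real.arctan (m / L)) = Real.pi := by
  have h := tsum_int_sub (u := fun m : ℤ => Real.arctan (m / L)) (a := Real.pi / 2)
    (b := -(Real.pi / 2))
    ((tendsto_nhds_of_tendsto_nhdsWithin Real.tendsto_arctan_atTop).comp
      (tendsto_intCast_div_atTop hL))
    ((tendsto_nhds_of_tendsto_nhdsWithin Real.tendsto_arctan_atBot).comp
      (tendsto_intCast_div_atBot hL)) (by
      push_cast
      exact summable_arctan hL)
  push_cast at h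
  rw [h]; ring

theorem norm_zpow_sub_one_le {z : ℂ} (hz : ‖z‖ = 1) (m : ℤ) : ‖z ^ m - 1‖ ≤ |(m : ℝ)| * ‖z - 1‖ := by
  have hz0 : z ≠ 0 := by rintro rfl; simp at hz
  have hn : ∀ n : ℕ, ‖z ^ n - 1‖ ≤ n * ‖z - 1‖ := by
    intro n
    induction n with
    | zero => simp
    | succ n ih =>
      calc ‖z ^ (n + 1) - 1‖ = ‖z ^ n * (z - 1) + (z ^ n - 1)‖ := by ring_nf
        _ ≤ ‖z ^ n * (z - 1)‖ + ‖z ^ n - 1‖ := norm_add_le _ _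
        _ ≤ ‖z - 1‖ + n * ‖z - 1‖ := by
          gcongr
          simp [hz]
        _ = _ := by push_cast; ring
  obtain ⟨n, rfl | rfl⟩ := m.eq_nat_or_neg
  · simpa using hn n
  · have h1 : z ^ (-(n : ℤ)) - 1 = -(z ^ (-(n : ℤ)) * (z ^ n - 1)) := by
      rw [mul_sub, zpow_neg, zpow_natCast, inv_mul_cancel₀ (pow_ne_zero _ hz0)]; ring
    rw [h1, norm_neg, norm_mul, norm_zpow, hz]
    simpa using hn n

/-- Interpolates between the trivial bound 2 and the linear bound. The linear bound alone would be
useless against a profile of size `1/(1 + t²)`, since `|t|/(1 + t²)` is not summable; `√|t|/(1 +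
t²)` is. -/
theorem norm_zpow_sub_one_le_sqrt {z : ℂ} (hz : ‖z‖ = 1) (m : ℤ) :
    ‖z ^ m - 1‖ ≤ 2 * √(|(m : ℝ)| * ‖z - 1‖) := by
  have h1 := norm_zpow_sub_one_le hz m
  have h2 : ‖z ^ m - 1‖ ≤ 2 := by
    refine (norm_sub_le _ _).trans ?_
    rw [norm_zpow, hz]; norm_num
  have h3 : ‖z ^ m - 1‖ ^ 2 ≤ 4 * (|(m : ℝ)| * ‖z - 1‖) := by
    nlinarith [norm_nonneg (z ^ m - 1)]
  calc ‖z ^ m - 1‖ ≤ √(4 * (|(m : ℝ)| * ‖z - 1‖)) := Real.le_sqrt_of_sq_le h3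
    _ = _ := by rw [Real.sqrt_mul (by norm_num), show √4 = 2 by rw [Real.sqrt_eq_iff_eq_sq] <;> norm_num]

theorem summable_int_add_one {f : ℤ → ℂ} (hf : Summable f) : Summable fun m => f (m + 1) :=
  (Equiv.addRight (1 : ℤ)).summable_iff.2 hf

theorem tsum_int_add_one (f : ℤ → ℂ) : ∑' m, f (m + 1) = ∑' m, f m :=
  (Equiv.addRight (1 : ℤ)).tsum_eq f

/-! ### Exponential sums of a profile of mean zero -/

/-- A profile on the line: a function that decays with its derivative like `1 / (1 + t²)` and
has vanishing integral, the latter being expressed by a primitive that vanishes at infinity. -/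
structure IsProfile (g H : ℝ → ℂ) (D : ℝ) : Prop where
  bound : ∀ t, ‖g t‖ ≤ D / (1 + t ^ 2)
  deriv_bound : ∀ t, ∃ g' : ℂ, HasDerivAt g g' t ∧ ‖g'‖ ≤ D / (1 + t ^ 2)
  primitive : ∀ t, HasDerivAt H (g t) t
  atTop : Tendsto H atTop (𝓝 0)
  atBot : Tendsto H atBot (𝓝 0)

namespace IsProfile

variable {g H : ℝ → ℂ} {D : ℝ}

theorem nonneg (h : IsProfile g H D) : 0 ≤ D := by
  simpa using (norm_nonneg _).trans (h.bound 0)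

/-- The derivative is dominated by that of `D * arctan`, so the variation of `g` over the whole line
is at most `D * π`. -/
theorem norm_sub_le (h : IsProfile g H D) {s t : ℝ} (hst : s ≤ t) :
    ‖g t - g s‖ ≤ D * (Real.arctan t - Real.arctan s) := by
  choose g' hg' hb using h.deriv_bound
  refine image_norm_le_of_norm_deriv_right_le_deriv_boundary (f := fun x => g x - g s)
    (f' := g') (a := s) (b := t) (B := fun x => D * (Real.arctan x - Real.arctan s))
    (B' := fun x => D * (1 / (1 + x ^ 2)))
    (fun x _ => ((hg' x).sub_const _).continuousAt.continuousWithinAt)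
    (fun x _ => ((hg' x).sub_const _).hasDerivWithinAt) (by simp)
    (fun x => ((Real.hasDerivAt_arctan x).sub_const _).const_mul D) (fun x _ => ?_)
    ⟨hst, le_rfl⟩
  rw [mul_one_div]
  exact hb x

theorem norm_primitive_sub_le (h : IsProfile g H D) {s t : ℝ} (hst : s ≤ t) :
    ‖H t - H s - (t - s) * g s‖ ≤ (t - s) * (D * (Real.arctan t - Real.arctan s)) := by
  have hd : ∀ x ∈ Set.Icc s t,
      HasDerivWithinAt (fun x : ℝ => H x - x * g s) (g x - 1 * g s) (Set.Icc s t) x := fun x _ =>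
    ((h.primitive x).sub ((Complex.ofRealCLM.hasDerivAt (x := x)).mul_const (g s))).hasDerivWithinAt
  have := (convex_Icc s t).norm_image_sub_le_of_norm_hasDerivWithin_le
    (C := D * (Real.arctan t - Real.arctan s)) hd (fun x hx => by
      rw [one_mul]
      refine (h.norm_sub_le hx.1).trans ?_
      have := h.nonneg
      gcongr
      exact hx.2) (Set.left_mem_Icc.2 hst) (Set.right_mem_Icc.2 hst)
  rw [Real.norm_of_nonneg (sub_nonneg.2 hst), mul_comm _ (t - s)] at this
  convert! this using 2
  ring

theorem summable_norm (h : IsProfile g H D) {L : ℝ} (hL : 0 < L) :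
    Summable fun m : ℤ => ‖g (m / L)‖ := by
  have hs : Summable fun m : ℤ => D * L ^ 2 * (1 / (m : ℝ) ^ 2) :=
    (Real.summable_one_div_int_pow.2 (by norm_num)).mul_left _
  refine hs.of_norm_bounded_eventually ?_
  have : ({0}ᶜ : Set ℤ) ∈ cofinite := (Set.finite_singleton _).compl_mem_cofinite
  filter_upwards [this] with m hm
  have hm' : (m : ℝ) ≠ 0 := by simpa using hm
  rw [norm_norm]
  refine (h.bound _).trans ?_
  have h0 := h.nonneg
  have e : D / (1 + (m / L) ^ 2) = D * L ^ 2 * (1 / (L ^ 2 + m ^ 2)) := by field_simp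
  rw [e]
  gcongr
  nlinarith [sq_nonneg L]

theorem norm_mul_zpow {z : ℂ} (hz : ‖z‖ = 1) (c : ℂ) (m : ℤ) : ‖c * z ^ m‖ = ‖c‖ := by
  simp [hz]

theorem summable (h : IsProfile g H D) {L : ℝ} (hL : 0 < L) {z : ℂ} (hz : ‖z‖ = 1) :
    Summable fun m : ℤ => g (m / L) * z ^ m :=
  Summable.of_norm (by simpa only [norm_mul_zpow hz] using h.summable_norm hL)

/-- Summation by parts: multiplying by `z - 1` replaces the values of `g` by their increments, whose
norms add up to at most the variation of `g`, whatever the mesh. -/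
theorem norm_mul_tsum_le (h : IsProfile g H D) {L : ℝ} (hL : 0 < L) {z : ℂ} (hz : ‖z‖ = 1) :
    ‖z - 1‖ * ‖∑' m : ℤ, g (m / L) * z ^ m‖ ≤ D * Real.pi := by
  have hz0 : z ≠ 0 := by rintro rfl; simp at hz
  have hs := h.summable hL hz
  have e : (z - 1) * ∑' m : ℤ, g (m / L) * z ^ m =
      ∑' m : ℤ, (g (m / L) - g (((m + 1 : ℤ) : ℝ) / L)) * z ^ (m + 1) := by
    have hs1 := summable_int_add_one hs
    have hs2 : Summable fun m : ℤ => g (m / L) * z ^ (m + 1) := by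
      refine (hs.mul_left z).congr fun m => ?_
      rw [zpow_add_one₀ hz0]; ring
    have h1 : ∑' m : ℤ, g (m / L) * z ^ m = ∑' m : ℤ, g (((m + 1 : ℤ) : ℝ) / L) * z ^ (m + 1) :=
      (tsum_int_add_one fun m : ℤ => g (m / L) * z ^ m).symm
    have h2 : z * ∑' m : ℤ, g (m / L) * z ^ m = ∑' m : ℤ, g (m / L) * z ^ (m + 1) := by
      rw [← tsum_mul_left]
      refine tsum_congr fun m => ?_
      rw [zpow_add_one₀ hz0]; ring
    rw [sub_mul, one_mul, h2, h1, ← hs2.tsum_sub hs1]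
    exact tsum_congr fun m => by ring
  rw [← norm_mul, e]
  have hA := (summable_arctan hL).mul_left D
  refine (tsum_of_norm_bounded hA.hasSum fun m => ?_).trans_eq ?_
  · rw [norm_mul_zpow hz, norm_sub_rev]
    push_cast
    exact h.norm_sub_le (by gcongr; linarith)
  · rw [tsum_mul_left, tsum_arctan hL]

/-- The sum is `L` times a Riemann sum of mesh `1/L` for an integral equal to zero. The Riemann sum
error is at most the mesh times the variation, so the factor `L` cancels; without mean zero the sum
could grow like `L`. -/
theorem norm_tsum_le (h : IsProfile g H D) {L : ℝ} (hL : 0 < L) :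
    ‖∑' m : ℤ, g (m / L)‖ ≤ D * Real.pi := by
  have hs : Summable fun m : ℤ => g (m / L) := by simpa using h.summable hL (z := 1) (by simp)
  have hA := (summable_arctan hL).mul_left D
  have hcell : ∀ m : ℤ, ‖H ((m + 1) / L) - H (m / L) - 1 / L * g (m / L)‖ ≤
      1 / L * (D * (Real.arctan ((m + 1) / L) - Real.arctan (m / L))) := fun m => by
    have := h.norm_primitive_sub_le (s := m / L) (t := (m + 1) / L) (by gcongr; linarith)
    have e : ((m : ℝ) + 1) / L - m / L = 1 / L := by ring
    rw [e, ← Complex.ofReal_sub, e] at this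
    simpa using this
  have hs1 : Summable fun m : ℤ => H ((m + 1) / L) - H (m / L) - 1 / L * g (m / L) :=
    Summable.of_norm_bounded (hA.mul_left (1 / L)) hcell
  have hs2 : Summable fun m : ℤ => H ((m + 1) / L) - H (m / L) := by
    refine (hs1.add (hs.mul_left (1 / (L : ℂ)))).congr fun m => ?_
    ring
  have hzero : ∑' m : ℤ, (H ((m + 1) / L) - H (m / L)) = 0 := by
    have := tsum_int_sub (u := fun m : ℤ => H (m / L))
      (h.atTop.comp (tendsto_intCast_div_atTop hL)) (h.atBot.comp (tendsto_intCast_div_atBot hL))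
      (by push_cast; exact hs2)
    push_cast at this
    simpa using this
  have hle : ‖∑' m : ℤ, (H ((m + 1) / L) - H (m / L) - 1 / L * g (m / L))‖ ≤
      1 / L * (D * Real.pi) := by
    refine (tsum_of_norm_bounded (hA.mul_left (1 / L)).hasSum hcell).trans_eq ?_
    rw [tsum_mul_left, tsum_mul_left, tsum_arctan hL]
  rw [hs2.tsum_sub (hs.mul_left _), hzero, tsum_mul_left, zero_sub, norm_neg, norm_mul] at hle
  have e : ‖1 / (L : ℂ)‖ = 1 / L := by simp [abs_of_pos hL]
  rw [e] at hle
  exact le_of_mul_le_mul_left hle (by positivity)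

end IsProfile

/-- With `t = n/L`, the inequality `t (1 + t) ≤ 2 (1 + t²)` reduces the summand to the form treated
in `exists_sum_bump_le` with exponent `1/2`. -/
theorem sqrt_div_le_bump {L : ℝ} (hL : 0 < L) {n : ℝ} (hn : 0 < n) :
    √(n / L) / (1 + (n / L) ^ 2) ≤ 2 * L * (1 / n * bump (√(1 / L) * n ^ (1 / 2 : ℝ))) := by
  have e : √(1 / L) * n ^ (1 / 2 : ℝ) = √(n / L) := by
    rw [← Real.sqrt_eq_rpow, ← Real.sqrt_mul (by positivity)]; congr 1; ring
  rw [e]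
  unfold bump
  rw [Real.sq_sqrt (by positivity)]
  set t := n / L with ht
  have ht0 : 0 < t := by positivity
  have e2 : 2 * L * (1 / n * (√t / (1 + t))) = √t * (2 / (t * (1 + t))) := by
    rw [ht]; field_simp
  rw [e2, div_eq_mul_inv]
  gcongr
  rw [inv_eq_one_div, div_le_div_iff₀ (by positivity) (by positivity)]
  nlinarith [sq_nonneg (t - 1)]

theorem summable_int_of_even {f : ℤ → ℝ} (hf : ∀ m, 0 ≤ f m) (h0 : f 0 = 0)
    (heven : ∀ m, f (-m) = f m) {C : ℝ} (hC : ∀ N : ℕ, ∑ n ∈ range N, f ((n + 1 : ℕ) : ℤ) ≤ C) :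
    Summable f ∧ ∑' m, f m ≤ 2 * C := by
  have hs : Summable fun n : ℕ => f ((n + 1 : ℕ) : ℤ) :=
    summable_of_sum_range_le (fun n => hf _) hC
  have ht := hs.tsum_le_of_sum_range_le hC
  push_cast at hs ht
  have hm : HasSum (fun n : ℕ => f (-((n : ℤ) + 1))) (∑' n : ℕ, f (n + 1)) := by
    simpa only [heven] using hs.hasSum
  have hall := hs.hasSum.of_add_one_of_neg_add_one hm
  refine ⟨hall.summable, hall.tsum_eq.trans_le ?_⟩
  rw [h0]
  linarith

/-- A Riemann sum bound for `√|t| / (1 + t²)`, uniform in the mesh. -/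
theorem exists_tsum_sqrt_le : ∃ C : ℝ, 0 ≤ C ∧ ∀ L : ℝ, 0 < L →
    Summable (fun m : ℤ => √|m / L| / (1 + (m / L) ^ 2)) ∧
    ∑' m : ℤ, √|m / L| / (1 + (m / L) ^ 2) ≤ C * L := by
  obtain ⟨C, hC, h⟩ := exists_sum_bump_le (δ := 1 / 2) (by norm_num)
  refine ⟨4 * C, by positivity, fun L hL => ?_⟩
  have hb : ∀ N, ∑ n ∈ range N, √(((n : ℝ) + 1) / L) / (1 + (((n : ℝ) + 1) / L) ^ 2) ≤
      2 * L * C := by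
    intro N
    refine (sum_le_sum fun n _ => sqrt_div_le_bump hL (by positivity)).trans ?_
    rw [← mul_sum]
    gcongr
    exact h _ (by positivity) N
  have h2 := summable_int_of_even (f := fun m : ℤ => √|m / L| / (1 + (m / L) ^ 2))
    (fun m => by positivity) (by simp) (fun m => by push_cast; rw [neg_div, abs_neg, neg_sq])
    (C := 2 * L * C) (fun N => (sum_congr rfl fun n _ => ?_).trans_le (hb N))
  · exact ⟨h2.1, h2.2.trans_eq (by ring)⟩
  · have h0 : 0 ≤ ((n : ℝ) + 1) / L := by positivity
    push_cast
    rw [abs_of_nonneg h0]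

namespace IsProfile

variable {g H : ℝ → ℂ} {D : ℝ}

/-- With `v = √(L‖z - 1‖)`, the sum is bounded by multiples of `L v + 1` (zero mean) and of `L / v²`
(summation by parts). The first is used for `v ≤ 1`, the second for `v ≥ 1`, and `bump v` dominates
both `v` and `1/v²` in the respective range, up to a factor 2. -/
theorem norm_tsum_zpow_le (h : IsProfile g H D) : ∃ C : ℝ, 0 ≤ C ∧ ∀ L : ℝ, 0 < L →
    ∀ z : ℂ, ‖z‖ = 1 →
    ‖∑' m : ℤ, g (m / L) * z ^ m‖ ≤ C * (L * bump (√(L * ‖z - 1‖)) + 1) := by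
  obtain ⟨B, hB, hsqrt⟩ := exists_tsum_sqrt_le
  have hD := h.nonneg
  refine ⟨4 * D * B + 2 * D * Real.pi, by positivity, fun L hL z hz => ?_⟩
  set S := ∑' m : ℤ, g (m / L) * z ^ m with hS
  set v := √(L * ‖z - 1‖) with hv
  have hv0 : 0 ≤ v := Real.sqrt_nonneg _
  have hvsq : v ^ 2 = L * ‖z - 1‖ := Real.sq_sqrt (by positivity)
  have hfar : v ^ 2 * ‖S‖ ≤ L * (D * Real.pi) := by
    rw [hvsq, mul_assoc]
    exact mul_le_mul_of_nonneg_left (h.norm_mul_tsum_le hL hz) hL.le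
  have hnear : ‖S‖ ≤ 2 * D * B * L * v + D * Real.pi := by
    obtain ⟨s1, s2⟩ := hsqrt L hL
    have hs0 : Summable fun m : ℤ => g (m / L) := by simpa using h.summable hL (z := 1) (by simp)
    have hterm : ∀ m : ℤ, ‖g (m / L) * (z ^ m - 1)‖ ≤
        2 * D * v * (√|m / L| / (1 + (m / L) ^ 2)) := fun m => by
      have e : √(|(m : ℝ)| * ‖z - 1‖) = √|m / L| * v := by
        rw [hv, ← Real.sqrt_mul (abs_nonneg _), abs_div, abs_of_pos hL]
        congr 1
        field_simp
      rw [norm_mul]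
      calc ‖g (m / L)‖ * ‖z ^ m - 1‖ ≤ D / (1 + (m / L) ^ 2) * (2 * (√|m / L| * v)) := by
            gcongr
            · exact h.bound _
            · exact e ▸ norm_zpow_sub_one_le_sqrt hz m
        _ = _ := by ring
    have hdiff : ‖∑' m : ℤ, g (m / L) * (z ^ m - 1)‖ ≤ 2 * D * v * (B * L) :=
      (tsum_of_norm_bounded (s1.mul_left (2 * D * v)).hasSum hterm).trans (by
        rw [tsum_mul_left]; gcongr)
    -- Splitting off the value at `z = 1` isolates the part controlled by the zero mean.
    have e : S = ∑' m : ℤ, g (m / L) * (z ^ m - 1) + ∑' m : ℤ, g (m / L) := by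
      rw [← (Summable.of_norm_bounded (s1.mul_left (2 * D * v)) hterm).tsum_add hs0]
      exact tsum_congr fun m => by ring
    rw [e]
    refine (norm_add_le _ _).trans ?_
    have := h.norm_tsum_le hL
    linarith
  have hpi := Real.pi_pos
  unfold bump
  rcases le_total v 1 with h1 | h1
  · have hb : v ≤ 2 * (v / (1 + v ^ 2)) := by
      rw [← mul_div_assoc, le_div_iff₀ (by positivity)]
      nlinarith [mul_le_mul_of_nonneg_left (pow_le_one₀ (n := 2) hv0 h1) hv0]
    have h2 : 2 * D * B * L * v ≤ 2 * D * B * L * (2 * (v / (1 + v ^ 2))) := by gcongr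
    have h3 : 0 ≤ 2 * D * Real.pi * (L * (v / (1 + v ^ 2))) := by positivity
    have h4 : 0 ≤ 4 * D * B := by positivity
    have h5 : 0 ≤ D * Real.pi := by positivity
    nlinarith
  · have hb : 1 / v ^ 2 ≤ 2 * (v / (1 + v ^ 2)) := by
      rw [← mul_div_assoc, div_le_div_iff₀ (by positivity) (by positivity)]
      nlinarith [mul_le_mul_of_nonneg_right h1 (sq_nonneg v), one_le_pow₀ (n := 2) h1]
    have h2 : ‖S‖ ≤ L * (D * Real.pi) * (1 / v ^ 2) := by
      rw [mul_one_div, le_div_iff₀ (by positivity)]; linarith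
    have h3 : L * (D * Real.pi) * (1 / v ^ 2) ≤ L * (D * Real.pi) * (2 * (v / (1 + v ^ 2))) := by
      gcongr
    have h4 : 0 ≤ 4 * D * B * (L * (v / (1 + v ^ 2))) := by positivity
    have h5 : 0 ≤ 4 * D * B + 2 * D * Real.pi := by positivity
    nlinarith

end IsProfile

/-! ### The rational profiles -/

theorem le_norm_ofReal_sub_I_mul (u p : ℝ) :
    min 1 |p| / 2 * (1 + |u|) ≤ ‖(u : ℂ) - Complex.I * p‖ := by
  have h1 : |u| ≤ ‖(u : ℂ) - Complex.I * p‖ := by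
    simpa using Complex.abs_re_le_norm ((u : ℂ) - Complex.I * p)
  have h2 : |p| ≤ ‖(u : ℂ) - Complex.I * p‖ := by
    simpa using Complex.abs_im_le_norm ((u : ℂ) - Complex.I * p)
  have h3 : min 1 |p| * |u| ≤ 1 * |u| := by gcongr; exact min_le_left _ _
  have h4 : min 1 |p| ≤ |p| := min_le_right _ _
  linarith

theorem ofReal_sub_I_mul_ne_zero (u : ℝ) {p : ℝ} (hp : p ≠ 0) : (u : ℂ) - Complex.I * p ≠ 0 := by
  have : 0 < |p| := abs_pos.2 hp
  have h : 0 < min 1 |p| / 2 * (1 + |u|) := by positivity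
  exact norm_pos_iff.1 (h.trans_le (le_norm_ofReal_sub_I_mul u p))

/-- The function `tʲ / ((tʲ⁺¹ - ip) (tʲ⁺¹ - iq))`. -/
def ratProfile (j : ℕ) (p q t : ℝ) : ℂ :=
  (t : ℂ) ^ j * (((t : ℂ) ^ (j + 1) - Complex.I * p)⁻¹ * ((t : ℂ) ^ (j + 1) - Complex.I * q)⁻¹)

/-- When `p` and `q` have the same sign the quotient has positive real part. This is how the
position of both poles in one half-plane enters: the principal logarithm of the quotient is smooth
along the whole line. -/
theorem div_sub_I_mul_mem_slitPlane (u : ℝ) {p q : ℝ} (hpq : 0 < p * q) :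
    ((u : ℂ) - Complex.I * p) / (u - Complex.I * q) ∈ Complex.slitPlane := by
  left
  have hq : q ≠ 0 := right_ne_zero_of_mul hpq.ne'
  have hn : 0 < u ^ 2 + q ^ 2 := by positivity
  have e : (((u : ℂ) - Complex.I * p) / (u - Complex.I * q)).re =
      (u ^ 2 + p * q) / (u ^ 2 + q ^ 2) := by
    rw [Complex.div_re]
    simp [Complex.normSq_apply]
    field_simp
  rw [e]
  positivity

theorem norm_inv_le (j : ℕ) {p : ℝ} (hp : p ≠ 0) (t : ℝ) :
    ‖((t : ℂ) ^ (j + 1) - Complex.I * p)⁻¹‖ ≤ 2 / min 1 |p| * (1 + |t| ^ (j + 1))⁻¹ := by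
  have h := le_norm_ofReal_sub_I_mul (t ^ (j + 1)) p
  have : 0 < |p| := abs_pos.2 hp
  have hmin : 0 < min 1 |p| := by positivity
  rw [norm_inv, abs_pow, Complex.ofReal_pow] at *
  calc _ ≤ (min 1 |p| / 2 * (1 + |t| ^ (j + 1)))⁻¹ := by gcongr
    _ = _ := by rw [mul_inv, inv_div]

theorem pow_le_one_add_pow {t : ℝ} (ht : 0 ≤ t) {i j : ℕ} (hij : i ≤ j) : t ^ i ≤ 1 + t ^ j := by
  rcases le_total t 1 with h | h
  · have := pow_le_one₀ (n := i) ht h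
    have := pow_nonneg ht j
    linarith
  · have := pow_le_pow_right₀ h hij
    linarith

theorem hasDerivAt_ofReal_pow (n : ℕ) (t : ℝ) :
    HasDerivAt (fun t : ℝ => (t : ℂ) ^ (n + 1)) ((n + 1 : ℕ) * (t : ℂ) ^ n) t := by
  simpa using (Complex.ofRealCLM.hasDerivAt (x := t)).fun_pow (n + 1)

theorem ratProfile_bound (j : ℕ) {p q : ℝ} (hp : p ≠ 0) (hq : q ≠ 0) (t : ℝ) :
    ‖ratProfile j p q t‖ ≤ 2 * (2 / min 1 |p| * (2 / min 1 |q|)) / (1 + t ^ 2) := by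
  have h1 := norm_inv_le j hp t
  have h2 := norm_inv_le j hq t
  set A := 2 / min 1 |p|
  set B := 2 / min 1 |q|
  have hA : 0 ≤ A := by positivity
  have hB : 0 ≤ B := by positivity
  unfold ratProfile
  rw [norm_mul, norm_mul, norm_pow, Complex.norm_real, Real.norm_eq_abs, ← sq_abs t]
  set x := |t|
  have hx : 0 ≤ x := abs_nonneg t
  have hP : x ^ j * (1 + x ^ 2) ≤ 2 * (1 + x ^ (j + 1)) ^ 2 := by
    have e1 := pow_le_one_add_pow hx (Nat.le_succ j)
    have e2 := pow_le_one_add_pow hx (Nat.le_add_left 1 j)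
    have e3 : x ^ j * (1 + x ^ 2) = x ^ j + x ^ 1 * x ^ (j + 1) := by ring
    have e4 := pow_nonneg hx (j + 1)
    rw [e3]
    simp only [Nat.succ_eq_add_one] at e1
    nlinarith [mul_le_mul_of_nonneg_right e2 e4]
  calc _ ≤ x ^ j * ((A * (1 + x ^ (j + 1))⁻¹) * (B * (1 + x ^ (j + 1))⁻¹)) := by gcongr
    _ = A * B * (x ^ j / (1 + x ^ (j + 1)) ^ 2) := by field_simp
    _ ≤ A * B * (2 / (1 + x ^ 2)) := by
      gcongr A * B * ?_
      rw [div_le_div_iff₀ (by positivity) (by positivity)]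
      exact hP
    _ = _ := by ring

theorem ratProfile_deriv_bound (j : ℕ) {p q : ℝ} (hp : p ≠ 0) (hq : q ≠ 0) : ∃ D : ℝ, 0 ≤ D ∧
    ∀ t, ∃ g' : ℂ, HasDerivAt (ratProfile j p q) g' t ∧ ‖g'‖ ≤ D / (1 + t ^ 2) := by
  set A := 2 / min 1 |p| with hAdef
  set B := 2 / min 1 |q| with hBdef
  have hA : 0 ≤ A := by positivity
  have hB : 0 ≤ B := by positivity
  refine ⟨2 * j * (A * B) + 2 * (j + 1) * (A ^ 2 * B + A * B ^ 2), by positivity, fun t => ?_⟩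
  have hinv : ∀ {p : ℝ}, p ≠ 0 → HasDerivAt
      (fun t : ℝ => ((t : ℂ) ^ (j + 1) - Complex.I * p)⁻¹)
      (-((j + 1 : ℕ) * (t : ℂ) ^ j) * ((t : ℂ) ^ (j + 1) - Complex.I * p)⁻¹ ^ 2) t := fun {p} hp => by
    have hne := ofReal_sub_I_mul_ne_zero (t ^ (j + 1)) hp
    rw [Complex.ofReal_pow] at hne
    convert! ((hasDerivAt_ofReal_pow j t).sub_const (Complex.I * p)).fun_inv hne using 1
    rw [div_eq_mul_inv, inv_pow]
  have hpow : HasDerivAt (fun t : ℝ => (t : ℂ) ^ j) (j * (t : ℂ) ^ (j - 1)) t := by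
    simpa using (Complex.ofRealCLM.hasDerivAt (x := t)).fun_pow j
  refine ⟨_, hpow.mul ((hinv hp).mul (hinv hq)), ?_⟩
  have h1 := norm_inv_le j hp t
  have h2 := norm_inv_le j hq t
  rw [← hAdef] at h1
  rw [← hBdef] at h2
  set P := ((t : ℂ) ^ (j + 1) - Complex.I * p)⁻¹
  set Q := ((t : ℂ) ^ (j + 1) - Complex.I * q)⁻¹
  have hnt : ‖(t : ℂ)‖ = |t| := by simp
  rw [← sq_abs t]
  set x := |t|
  have hx : 0 ≤ x := abs_nonneg t
  set T := 1 + x ^ (j + 1) with hT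
  have hTp : 1 ≤ T := by
    have := pow_nonneg hx (j + 1)
    linarith
  have hT0 : 0 < T := by linarith
  -- The factor `j` is kept to dispose of `j = 0`, where the truncated exponent `j - 1` breaks the
  -- identity `x^(j-1) * x^2 = x^(j+1)`.
  have hP1 : j * (x ^ (j - 1) * (1 + x ^ 2)) ≤ j * (2 * T ^ 2) := by
    rcases Nat.eq_zero_or_pos j with rfl | hj
    · simp
    · refine mul_le_mul_of_nonneg_left ?_ (Nat.cast_nonneg j)
      have e1 := pow_le_one_add_pow hx (show j - 1 ≤ j + 1 by omega)
      have e2 : x ^ (j - 1) * x ^ 2 = x ^ (j + 1) := by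
        rw [← pow_add]; congr 1; omega
      nlinarith
  have hP2 : x ^ j * x ^ j * (1 + x ^ 2) ≤ 2 * T ^ 3 := by
    have e1 := pow_le_one_add_pow hx (Nat.le_succ j)
    have e3 : x ^ j * x ^ j * (1 + x ^ 2) = x ^ j * x ^ j + x ^ (j + 1) * x ^ (j + 1) := by ring
    have e4 := pow_nonneg hx (j + 1)
    have e6 := pow_nonneg hx j
    have e5 : x ^ j * x ^ j ≤ T * T := by gcongr
    have e7 : x ^ (j + 1) * x ^ (j + 1) ≤ T * T := by gcongr <;> linarith
    have e8 : T ^ 2 ≤ T ^ 3 := pow_le_pow_right₀ hTp (by norm_num)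
    rw [e3]
    nlinarith
  have hQ1 : j * x ^ (j - 1) / T ^ 2 ≤ 2 * j / (1 + x ^ 2) := by
    rw [div_le_div_iff₀ (by positivity) (by positivity)]; linarith
  have hQ2 : x ^ j * x ^ j / T ^ 3 ≤ 2 / (1 + x ^ 2) := by
    rw [div_le_div_iff₀ (by positivity) (by positivity)]; linarith
  calc ‖_‖ ≤ j * x ^ (j - 1) * (‖P‖ * ‖Q‖) +
        x ^ j * ((j + 1) * x ^ j * ‖P‖ ^ 2 * ‖Q‖ + ‖P‖ * ((j + 1) * x ^ j * ‖Q‖ ^ 2)) := by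
        refine (norm_add_le _ _).trans ?_
        rw [norm_mul, norm_mul, norm_mul, norm_mul (_ ^ j), norm_pow, norm_pow, hnt,
          Complex.norm_natCast]
        gcongr
        refine (norm_add_le _ _).trans (le_of_eq ?_)
        simp only [norm_mul, norm_neg, norm_pow, hnt, Complex.norm_natCast]
        push_cast
        ring
    _ ≤ j * x ^ (j - 1) * ((A * T⁻¹) * (B * T⁻¹)) +
        x ^ j * ((j + 1) * x ^ j * (A * T⁻¹) ^ 2 * (B * T⁻¹) +
          (A * T⁻¹) * ((j + 1) * x ^ j * (B * T⁻¹) ^ 2)) := by gcongr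
    _ = A * B * (j * x ^ (j - 1) / T ^ 2) +
        (j + 1) * (A ^ 2 * B + A * B ^ 2) * (x ^ j * x ^ j / T ^ 3) := by field_simp
    _ ≤ A * B * (2 * j / (1 + x ^ 2)) +
        (j + 1) * (A ^ 2 * B + A * B ^ 2) * (2 / (1 + x ^ 2)) := by gcongr
    _ = _ := by ring

/-- By partial fractions, a primitive is a multiple of `log ((t^(j+1) - ip)/(t^(j+1) - iq))`; this
uses `p ≠ q`. The quotient stays in the slit plane and tends to 1 at both ends, so the primitive
vanishes at both ends. -/
theorem exists_isProfile (j : ℕ) {p q : ℝ} (hpq : 0 < p * q) (hne : p ≠ q) :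
    ∃ H D, IsProfile (ratProfile j p q) H D := by
  have hp : p ≠ 0 := left_ne_zero_of_mul hpq.ne'
  have hq : q ≠ 0 := right_ne_zero_of_mul hpq.ne'
  obtain ⟨D, hD, hderiv⟩ := ratProfile_deriv_bound j hp hq
  set c : ℂ := ((j + 1 : ℕ) * (Complex.I * (p - q)))⁻¹ with hc
  set B := 2 * (2 / min 1 |p| * (2 / min 1 |q|)) with hB
  have hB0 : 0 ≤ B := by positivity
  have hlim : ∀ F : Filter ℝ, Tendsto (fun t => |t|) F atTop → Tendsto (fun t : ℝ => c * Complex.log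
      (((t : ℂ) ^ (j + 1) - Complex.I * p) / ((t : ℂ) ^ (j + 1) - Complex.I * q))) F (𝓝 0) := by
    intro F hF
    have h0 : Tendsto (fun t : ℝ => ((t : ℂ) ^ (j + 1) - Complex.I * q)⁻¹) F (𝓝 0) := by
      refine squeeze_zero_norm' (a := fun t => 2 / min 1 |q| * (|t|⁻¹) ^ (j + 1)) ?_ ?_
      · filter_upwards [hF.eventually_gt_atTop 0] with t ht
        refine (norm_inv_le j hq t).trans ?_
        rw [inv_pow]
        gcongr
        linarith
      · simpa using ((tendsto_inv_atTop_zero.comp hF).pow (j + 1)).const_mul (2 / min 1 |q|)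
    have h1 : Tendsto (fun t : ℝ => ((t : ℂ) ^ (j + 1) - Complex.I * p) /
        ((t : ℂ) ^ (j + 1) - Complex.I * q)) F (𝓝 1) := by
      -- The quotient equals `1 + i(q - p)/(t^(j+1) - iq)`.
      have := (h0.const_mul (Complex.I * (q - p))).const_add 1
      rw [mul_zero, add_zero] at this
      refine this.congr fun t => ?_
      have hne := ofReal_sub_I_mul_ne_zero (t ^ (j + 1)) hq
      rw [Complex.ofReal_pow] at hne
      field_simp
      ring
    have h2 := ((continuousAt_clog Complex.one_mem_slitPlane).tendsto.comp h1).const_mul c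
    simpa using h2
  refine ⟨fun t => c * Complex.log
    (((t : ℂ) ^ (j + 1) - Complex.I * p) / ((t : ℂ) ^ (j + 1) - Complex.I * q)), B + D,
    fun t => ?_, fun t => ?_, fun t => ?_, ?_, ?_⟩
  · refine (ratProfile_bound j hp hq t).trans ?_
    gcongr
    linarith
  · obtain ⟨g', h1, h2⟩ := hderiv t
    refine ⟨g', h1, h2.trans ?_⟩
    gcongr
    linarith
  · have hnp := ofReal_sub_I_mul_ne_zero (t ^ (j + 1)) hp
    have hnq := ofReal_sub_I_mul_ne_zero (t ^ (j + 1)) hq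
    have hs := div_sub_I_mul_mem_slitPlane (t ^ (j + 1)) hpq
    rw [Complex.ofReal_pow] at hnp hnq hs
    have hd := hasDerivAt_ofReal_pow j t
    have := (((hd.sub_const (Complex.I * p)).fun_div (hd.sub_const (Complex.I * q)) hnq).clog_real
      hs).const_mul c
    convert! this using 1
    have hpq' : (p : ℂ) - q ≠ 0 := by exact_mod_cast sub_ne_zero.2 hne
    have hj1 : ((j + 1 : ℕ) : ℂ) ≠ 0 := by exact_mod_cast j.succ_ne_zero
    rw [hc, ratProfile]
    have hI := Complex.I_ne_zero
    field_simp
    ring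
  · exact hlim _ tendsto_abs_atTop_atTop
  · exact hlim _ tendsto_abs_atBot_atTop

/-! ### The symbol and its bounded kernel -/

/-- The symbol `|m|ᵏ⁻¹ |n|ˡ⁻¹ / ((mᵏ - ip nˡ) (mᵏ - iq nˡ))`. -/
def symbol (k l : ℕ) (p q : ℝ) (m n : ℤ) : ℂ :=
  ((|(m : ℝ)| ^ (k - 1) * |(n : ℝ)| ^ (l - 1) : ℝ) : ℂ) *
    (((m : ℂ) ^ k - Complex.I * p * (n : ℂ) ^ l)⁻¹ * ((m : ℂ) ^ k - Complex.I * q * (n : ℂ) ^ l)⁻¹)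

/-- Factoring out `-ip` gives `mᵏ - ip nˡ = -ip (nˡ - i(-p⁻¹) mᵏ)`. The new parameters are again
distinct and of the same sign when the old ones are, so the case of odd `l` reduces to that of odd
`k`. -/
theorem symbol_swap (k l : ℕ) {p q : ℝ} (hp : p ≠ 0) (hq : q ≠ 0) (m n : ℤ) :
    symbol k l p q m n = -(1 / (p * q)) * symbol l k (-p⁻¹) (-q⁻¹) n m := by
  have h : ∀ {p : ℝ}, p ≠ 0 → ((m : ℂ) ^ k - Complex.I * p * (n : ℂ) ^ l)⁻¹ =
      -(Complex.I * p)⁻¹ * ((n : ℂ) ^ l - Complex.I * (-p⁻¹ : ℝ) * (m : ℂ) ^ k)⁻¹ := by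
    intro p hp
    have hp' : (p : ℂ) ≠ 0 := by exact_mod_cast hp
    rw [← inv_neg, ← mul_inv]
    congr 1
    push_cast
    have : Complex.I * p * (Complex.I * (p : ℂ)⁻¹) = -1 := by
      rw [mul_mul_mul_comm, Complex.I_mul_I, mul_inv_cancel₀ hp', mul_one]
    linear_combination (m : ℂ) ^ k * this
  unfold symbol
  rw [h hp, h hq, mul_comm (|(m : ℝ)| ^ (k - 1))]
  have : (Complex.I * (p : ℂ))⁻¹ * (Complex.I * (q : ℂ))⁻¹ = -(1 / (p * q)) := by
    rw [← mul_inv, mul_mul_mul_comm, Complex.I_mul_I, neg_one_mul, inv_neg, one_div]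
  rw [← this]
  ring

/-- Homogeneity: with `L = |n|^(l/k)` one has `Lᵏ = |n|ˡ`, so `m = L t` scales out. Oddness of `k`
turns `|m|ᵏ⁻¹` into `mᵏ⁻¹`, and `ε` is the sign of `nˡ`. Changing both signs at once preserves `p *
q > 0`. -/
theorem symbol_eq {k : ℕ} (hk : Odd k) {l : ℕ} (hl : 1 ≤ l) (p q : ℝ) {n : ℤ} (hn : n ≠ 0) :
    ∃ ε : ℝ, (ε = 1 ∨ ε = -1) ∧ ∀ m : ℤ, symbol k l p q m n =
      ((1 / (|(n : ℝ)| * |(n : ℝ)| ^ ((l : ℝ) / k)) : ℝ) : ℂ) *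
        ratProfile (k - 1) (ε * p) (ε * q) (m / |(n : ℝ)| ^ ((l : ℝ) / k)) := by
  set a := |(n : ℝ)| with ha
  have ha0 : 0 < a := abs_pos.2 (by exact_mod_cast hn)
  set L := a ^ ((l : ℝ) / k) with hL
  have hL0 : 0 < L := by positivity
  have hk1 : k - 1 + 1 = k := Nat.sub_add_cancel hk.pos
  have hl1 : l - 1 + 1 = l := Nat.sub_add_cancel hl
  have hLk : L ^ k = a ^ l := by
    rw [hL, ← Real.rpow_natCast, ← Real.rpow_mul ha0.le, div_mul_cancel₀, Real.rpow_natCast]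
    exact_mod_cast hk.pos.ne'
  obtain ⟨ε, hε, hnε⟩ : ∃ ε : ℝ, (ε = 1 ∨ ε = -1) ∧ (n : ℝ) ^ l = ε * a ^ l := by
    rcases abs_choice (n : ℝ) with h | h
    · exact ⟨1, Or.inl rfl, by rw [ha, h, one_mul]⟩
    · rcases Nat.even_or_odd l with hl | hl
      · exact ⟨1, Or.inl rfl, by rw [ha, h, hl.neg_pow, one_mul]⟩
      · exact ⟨-1, Or.inr rfl, by rw [ha, h, hl.neg_pow]; ring⟩
  refine ⟨ε, hε, fun m => ?_⟩
  have hLC : (L : ℂ) ≠ 0 := by exact_mod_cast hL0.ne'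
  have haC : (a : ℂ) ≠ 0 := by exact_mod_cast ha0.ne'
  have hfac : ∀ p : ℝ, (m : ℂ) ^ k - Complex.I * p * (n : ℂ) ^ l =
      (L : ℂ) ^ k * (((m / L : ℝ) : ℂ) ^ (k - 1 + 1) - Complex.I * (ε * p : ℝ)) := by
    intro p
    have e : (n : ℂ) ^ l = ε * L ^ k := by
      rw [← hLk] at hnε
      exact_mod_cast hnε
    rw [hk1, e]
    push_cast
    rw [div_pow, mul_sub, mul_div_cancel₀ _ (pow_ne_zero _ hLC)]
    ring
  have habs : |(m : ℝ)| ^ (k - 1) = (m : ℝ) ^ (k - 1) :=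
    (Nat.Odd.sub_odd hk odd_one).pow_abs _
  have hLk' : (L : ℂ) ^ (k - 1) * L = a ^ (l - 1) * a := by
    rw [← pow_succ, ← pow_succ, hk1, hl1]
    exact_mod_cast hLk
  unfold symbol ratProfile
  rw [hfac, hfac, habs, mul_inv, mul_inv]
  have hm : (((m : ℝ) ^ (k - 1) * a ^ (l - 1) : ℝ) : ℂ) * (((L : ℂ) ^ k)⁻¹ * ((L : ℂ) ^ k)⁻¹) =
      ((1 / (a * L) : ℝ) : ℂ) * ((m / L : ℝ) : ℂ) ^ (k - 1) := by
    have e : (L : ℂ) ^ k = L ^ (k - 1) * L := by rw [← pow_succ, hk1]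
    have e2 : (a : ℂ) ^ (l - 1) = L ^ (k - 1) * L / a := by rw [hLk']; field_simp
    push_cast
    rw [e, e2, div_pow]
    field_simp
  rw [← mul_assoc _ (_ ^ (k - 1)), ← hm]
  ring

theorem exists_norm_tsum_symbol_le {k : ℕ} (hk : Odd k) {l : ℕ} (hl : 1 ≤ l) {p q : ℝ}
    (hpq : 0 < p * q) (hne : p ≠ q) : ∃ C : ℝ, 0 ≤ C ∧ ∀ n : ℤ, n ≠ 0 → ∀ z : ℂ, ‖z‖ = 1 →
      (Summable fun m : ℤ => ‖symbol k l p q m n‖) ∧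
      ‖∑' m : ℤ, symbol k l p q m n * z ^ m‖ ≤
        C * (1 / |(n : ℝ)| * bump (√‖z - 1‖ * |(n : ℝ)| ^ ((l : ℝ) / k / 2)) +
          1 / |(n : ℝ)| ^ (1 + (l : ℝ) / k)) := by
  obtain ⟨H₁, D₁, h₁⟩ := exists_isProfile (k - 1) hpq hne
  obtain ⟨H₂, D₂, h₂⟩ := exists_isProfile (k - 1) (p := -1 * p) (q := -1 * q)
    (by linarith) (by simpa using hne)
  obtain ⟨C₁, hC₁, hb₁⟩ := h₁.norm_tsum_zpow_le
  obtain ⟨C₂, hC₂, hb₂⟩ := h₂.norm_tsum_zpow_le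
  refine ⟨C₁ + C₂, by positivity, fun n hn z hz => ?_⟩
  obtain ⟨ε, hε, hs⟩ := symbol_eq hk hl p q hn
  set a := |(n : ℝ)| with ha
  have ha0 : 0 < a := abs_pos.2 (by exact_mod_cast hn)
  set L := a ^ ((l : ℝ) / k) with hL
  have hL0 : 0 < L := by positivity
  have hsqrt : √(L * ‖z - 1‖) = √‖z - 1‖ * a ^ ((l : ℝ) / k / 2) := by
    rw [mul_comm, Real.sqrt_mul (norm_nonneg _), Real.sqrt_eq_rpow L, hL, ← Real.rpow_mul ha0.le]
    congr 2; ring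
  have haL : a ^ (1 + (l : ℝ) / k) = a * L := by rw [Real.rpow_add ha0, Real.rpow_one]
  have key : ∃ H D, IsProfile (ratProfile (k - 1) (ε * p) (ε * q)) H D ∧
      ‖∑' m : ℤ, ratProfile (k - 1) (ε * p) (ε * q) (m / L) * z ^ m‖ ≤
        (C₁ + C₂) * (L * bump (√(L * ‖z - 1‖)) + 1) := by
    have hbn := bump_nonneg (Real.sqrt_nonneg (L * ‖z - 1‖))
    rcases hε with rfl | rfl
    · rw [one_mul, one_mul]
      refine ⟨H₁, D₁, h₁, (hb₁ L hL0 z hz).trans ?_⟩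
      gcongr
      linarith
    · refine ⟨H₂, D₂, h₂, (hb₂ L hL0 z hz).trans ?_⟩
      gcongr
      linarith
  obtain ⟨H, D, h, hb⟩ := key
  simp only [hs]
  refine ⟨?_, ?_⟩
  · simp only [norm_mul]
    exact (h.summable_norm hL0).mul_left _
  · simp only [mul_assoc]
    rw [tsum_mul_left, norm_mul, Complex.norm_real, Real.norm_of_nonneg (by positivity), ← hsqrt,
      haL]
    calc _ ≤ 1 / (a * L) * ((C₁ + C₂) * (L * bump (√(L * ‖z - 1‖)) + 1)) := by gcongr
      _ = _ := by field_simp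

/-- The row bounds add up over `n` by `exists_sum_bump_le` with `b = √‖z - 1‖` and by the
convergence of `Σ n^(-1-l/k)`. Truncation to finitely many rows gives absolute summability, with a
bound independent of the truncation. -/
theorem exists_kernel_bound {k : ℕ} (hk : Odd k) {l : ℕ} (hl : 1 ≤ l) {p q : ℝ}
    (hpq : 0 < p * q) (hne : p ≠ q) : ∃ C : ℝ, 0 ≤ C ∧ ∀ S : Finset ℤ, 0 ∉ S →
      (Summable fun x : ℤ × ℤ => ‖if x.1 ∈ S then symbol k l p q x.2 x.1 else 0‖) ∧
      ∀ z w : ℂ, ‖z‖ = 1 → ‖w‖ = 1 →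
        ‖∑' x : ℤ × ℤ, (if x.1 ∈ S then symbol k l p q x.2 x.1 else 0) *
          (z ^ x.2 * w ^ x.1)‖ ≤ C := by
  obtain ⟨C, hC, hsym⟩ := exists_norm_tsum_symbol_le hk hl hpq hne
  have hkl : 0 < (l : ℝ) / k := by
    have := hk.pos
    positivity
  obtain ⟨B, hB, hbump⟩ := exists_sum_bump_le (half_pos hkl)
  have hser : Summable fun n : ℕ => 1 / ((n + 1 : ℕ) : ℝ) ^ (1 + (l : ℝ) / k) :=
    (summable_nat_add_iff 1).2 (Real.summable_one_div_nat_rpow.2 (by linarith))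
  set T := ∑' n : ℕ, 1 / ((n + 1 : ℕ) : ℝ) ^ (1 + (l : ℝ) / k) with hT
  have hT0 : 0 ≤ T := tsum_nonneg fun n => by positivity
  refine ⟨2 * (C * (B + T)), by positivity, fun S hS => ?_⟩
  have hsummable : Summable fun x : ℤ × ℤ => ‖if x.1 ∈ S then symbol k l p q x.2 x.1 else 0‖ := by
    refine (summable_prod_of_nonneg fun x => norm_nonneg _).2 ⟨fun n => ?_, ?_⟩
    · by_cases hn : n ∈ S
      · simpa [hn] using (hsym n (ne_of_mem_of_not_mem hn hS) 1 (by simp)).1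
      · simp [hn]
    · refine summable_of_ne_finset_zero (s := S) fun n hn => ?_
      simp [hn]
  refine ⟨hsummable, fun z w hz hw => ?_⟩
  have hs2 : Summable fun x : ℤ × ℤ => (if x.1 ∈ S then symbol k l p q x.2 x.1 else 0) *
      (z ^ x.2 * w ^ x.1) :=
    Summable.of_norm (hsummable.congr fun x => by
      simp only [norm_mul, norm_zpow, hz, hw, one_zpow, mul_one])
  set f : ℤ → ℝ := fun n => C * (1 / |(n : ℝ)| * bump (√‖z - 1‖ * |(n : ℝ)| ^ ((l : ℝ) / k / 2)) +
    1 / |(n : ℝ)| ^ (1 + (l : ℝ) / k)) with hf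
  have hf0 : ∀ n, 0 ≤ f n := fun n => by
    have := bump_nonneg (v := √‖z - 1‖ * |(n : ℝ)| ^ ((l : ℝ) / k / 2)) (by positivity)
    positivity
  obtain ⟨hfs, hft⟩ := summable_int_of_even hf0
    -- At `n = 0` the majorant is 0 by the convention for division by zero, which is harmless since
    -- `0 ∉ S`.
    (by simp [hf, Real.zero_rpow (by positivity : 1 + (l : ℝ) / k ≠ 0)])
    (fun m => by simp [hf]) (C := C * (B + T)) (fun N => by
      simp only [hf]
      rw [← mul_sum, sum_add_distrib]
      gcongr
      · refine le_trans (le_of_eq (sum_congr rfl fun n _ => ?_))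
          (hbump √‖z - 1‖ (Real.sqrt_nonneg _) N)
        have h0 : (0 : ℝ) ≤ (n : ℝ) + 1 := by positivity
        push_cast
        rw [abs_of_nonneg h0]
      · refine le_trans (le_of_eq (sum_congr rfl fun n _ => ?_))
          (hser.sum_le_tsum (range N) fun n _ => by positivity)
        have h0 : (0 : ℝ) ≤ (n : ℝ) + 1 := by positivity
        push_cast
        rw [abs_of_nonneg h0])
  rw [hs2.tsum_prod, tsum_eq_sum (s := S) fun n hn => by simp [hn]]
  refine (norm_sum_le_of_le S fun n hn => ?_).trans ((hfs.sum_le_tsum S fun n _ => hf0 n).trans hft)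
  have e : ∑' m : ℤ, (if n ∈ S then symbol k l p q m n else 0) * (z ^ m * w ^ n) =
      (∑' m : ℤ, symbol k l p q m n * z ^ m) * w ^ n := by
    rw [← tsum_mul_right]
    exact tsum_congr fun m => by rw [if_pos hn, mul_assoc]
  rw [e, norm_mul, norm_zpow, hw, one_zpow, mul_one]
  exact (hsym n (ne_of_mem_of_not_mem hn hS) z hz).2

/-! ### Characters of the torus and transfer of the kernel bound -/

theorem fourier_eq_zpow (m : ℤ) (t : UnitAddCircle) : fourier m t = fourier 1 t ^ m := by
  rw [fourier_apply, fourier_apply, AddCircle.toCircle_zsmul, one_zsmul, Circle.coe_zpow]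

theorem norm_fourier_apply (m : ℤ) (t : UnitAddCircle) : ‖fourier m t‖ = 1 := by
  rw [fourier_apply, Circle.norm_coe]

theorem mFourier_eq_zpow (n : Fin 2 → ℤ) (y : T2) :
    mFourier n y = fourier 1 (y 0) ^ n 0 * fourier 1 (y 1) ^ n 1 := by
  rw [mFourier, ContinuousMap.coe_mk, Fin.prod_univ_two, fourier_eq_zpow, fourier_eq_zpow (n 1)]

theorem mFourier_add_apply (n : Fin 2 → ℤ) (x y : T2) :
    mFourier n (x + y) = mFourier n x * mFourier n y := by
  have h : ∀ s t : UnitAddCircle, fourier 1 (s + t) = fourier 1 s * fourier 1 t := fun s t => by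
    simp only [fourier_apply, one_zsmul, AddCircle.toCircle_add, Circle.coe_mul]
  simp only [mFourier_eq_zpow, Pi.add_apply, h, mul_zpow]
  ring

theorem mFourier_neg_apply (n : Fin 2 → ℤ) (x : T2) : mFourier (-n) x = mFourier n (-x) := by
  have h : ∀ t : UnitAddCircle, fourier 1 (-t) = (fourier 1 t)⁻¹ := fun t => by
    simp only [fourier_apply, one_zsmul, AddCircle.toCircle_neg, Circle.coe_inv]
  simp only [mFourier_eq_zpow, Pi.neg_apply, h, inv_zpow, zpow_neg]

theorem summable_fin_two_iff {E : Type*} [AddCommGroup E] [TopologicalSpace E] (f : ℤ → ℤ → E) :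
    (Summable fun n : Fin 2 → ℤ => f (n 0) (n 1)) ↔ Summable fun x : ℤ × ℤ => f x.1 x.2 :=
  (finTwoArrowEquiv ℤ).summable_iff (f := fun x : ℤ × ℤ => f x.1 x.2)

theorem tsum_fin_two {E : Type*} [AddCommGroup E] [TopologicalSpace E] (f : ℤ → ℤ → E) :
    ∑' n : Fin 2 → ℤ, f (n 0) (n 1) = ∑' x : ℤ × ℤ, f x.1 x.2 :=
  (finTwoArrowEquiv ℤ).tsum_eq fun x : ℤ × ℤ => f x.1 x.2

theorem summable_fin_two_iff_swap {E : Type*} [AddCommGroup E] [TopologicalSpace E]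
    (f : ℤ → ℤ → E) :
    (Summable fun n : Fin 2 → ℤ => f (n 1) (n 0)) ↔ Summable fun x : ℤ × ℤ => f x.1 x.2 :=
  ((finTwoArrowEquiv ℤ).trans (Equiv.prodComm _ _)).summable_iff (f := fun x : ℤ × ℤ => f x.1 x.2)

theorem tsum_fin_two_swap {E : Type*} [AddCommGroup E] [TopologicalSpace E] (f : ℤ → ℤ → E) :
    ∑' n : Fin 2 → ℤ, f (n 1) (n 0) = ∑' x : ℤ × ℤ, f x.1 x.2 :=
  ((finTwoArrowEquiv ℤ).trans (Equiv.prodComm _ _)).tsum_eq fun x : ℤ × ℤ => f x.1 x.2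

/-- The index `i` marks the coordinate that is truncated and summed last: the second one if `k` is
odd, otherwise the first one after exchanging the variables. -/
theorem exists_kernel_bound_torus {k l : ℕ} (hk : 1 ≤ k) (hl : 1 ≤ l) (hodd : Odd k ∨ Odd l) :
    ∃ i : Fin 2, ∀ p q : ℝ, 0 < p * q → p ≠ q → ∃ C : ℝ, 0 ≤ C ∧ ∀ S : Finset ℤ, 0 ∉ S →
      (Summable fun n : Fin 2 → ℤ => ‖if n i ∈ S then symbol k l p q (n 0) (n 1) else 0‖) ∧
      ∀ y : T2, ‖∑' n : Fin 2 → ℤ, (if n i ∈ S then symbol k l p q (n 0) (n 1) else 0) *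
        mFourier n y‖ ≤ C := by
  rcases hodd with hodd | hodd
  · refine ⟨1, fun p q hpq hne => ?_⟩
    obtain ⟨C, hC, h⟩ := exists_kernel_bound hodd hl hpq hne
    refine ⟨C, hC, fun S hS => ?_⟩
    obtain ⟨h1, h2⟩ := h S hS
    refine ⟨(summable_fin_two_iff_swap fun a b => ‖if a ∈ S then symbol k l p q b a else 0‖).2 h1,
      fun y => ?_⟩
    simp only [mFourier_eq_zpow]
    rw [tsum_fin_two_swap fun a b => (if a ∈ S then symbol k l p q b a else 0) *
      (fourier 1 (y 0) ^ b * fourier 1 (y 1) ^ a)]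
    exact h2 _ _ (norm_fourier_apply _ _) (norm_fourier_apply _ _)
  · refine ⟨0, fun p q hpq hne => ?_⟩
    have hp : p ≠ 0 := left_ne_zero_of_mul hpq.ne'
    have hq : q ≠ 0 := right_ne_zero_of_mul hpq.ne'
    obtain ⟨C, hC, h⟩ := exists_kernel_bound hodd hk (p := -p⁻¹) (q := -q⁻¹)
      (by rw [neg_mul_neg, ← mul_inv]; positivity) (by simpa using hne)
    refine ⟨‖-(1 / ((p : ℂ) * q))‖ * C, by positivity, fun S hS => ?_⟩
    obtain ⟨h1, h2⟩ := h S hS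
    have hsw : ∀ n : Fin 2 → ℤ, (if n 0 ∈ S then symbol k l p q (n 0) (n 1) else 0) =
        -(1 / ((p : ℂ) * q)) *
          (if n 0 ∈ S then symbol l k (-p⁻¹) (-q⁻¹) (n 1) (n 0) else 0) := fun n => by
      rw [symbol_swap k l hp hq, mul_ite, mul_zero]
    simp only [hsw]
    refine ⟨?_, fun y => ?_⟩
    · simp only [norm_mul]
      exact ((summable_fin_two_iff fun a b =>
        ‖if a ∈ S then symbol l k (-p⁻¹) (-q⁻¹) b a else 0‖).2 h1).mul_left _
    · simp only [mul_assoc]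
      rw [tsum_mul_left, norm_mul]
      gcongr
      simp only [mFourier_eq_zpow]
      rw [tsum_fin_two fun a b => (if a ∈ S then symbol l k (-p⁻¹) (-q⁻¹) b a else 0) *
        (fourier 1 (y 0) ^ a * fourier 1 (y 1) ^ b)]
      refine le_trans (le_of_eq ?_)
        (h2 (fourier 1 (y 1)) (fourier 1 (y 0)) (norm_fourier_apply _ _) (norm_fourier_apply _ _))
      congr 1
      exact tsum_congr fun x => by ring

/-! ### Bounded kernels acting on pairs of functionals -/

/-- A summable family of Fourier coefficients with a bounded sum is a bounded bilinear form on the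
dual of the space of continuous functions. -/
theorem norm_tsum_mul_conj_le {c : (Fin 2 → ℤ) → ℂ} (hc : Summable fun n => ‖c n‖) {C : ℝ}
    (hC0 : 0 ≤ C) (hC : ∀ y : T2, ‖∑' n, c n * mFourier n y‖ ≤ C) (Λ Γ : C(T2, ℂ) →L[ℂ] ℂ) :
    (Summable fun n => c n * (Λ (mFourier (-n)) * conj (Γ (mFourier (-n))))) ∧
    ‖∑' n, c n * (Λ (mFourier (-n)) * conj (Γ (mFourier (-n))))‖ ≤ C * (‖Λ‖ * ‖Γ‖) := by
  have hΛ : ∀ n, ‖Λ (mFourier n)‖ ≤ ‖Λ‖ := fun n => by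
    simpa [mFourier_norm] using Λ.le_opNorm (mFourier n)
  -- For fixed `y`, this is `Λ` applied to the translated kernel `x ↦ K(y - x)`, whose supremum is
  -- at most `C`. The functional `Γ` is then applied, up to conjugation, to the resulting function
  -- of `y`.
  have hker : ∀ y, ‖∑' n, c n * Λ (mFourier (-n)) * mFourier n y‖ ≤ ‖Λ‖ * C := by
    intro y
    have hn : ∀ n, ‖mFourier n y‖ ≤ 1 := fun n =>
      ((mFourier n).norm_coe_le_norm y).trans_eq mFourier_norm
    have hs : Summable fun n => (c n * mFourier n y) • (mFourier (-n) : C(T2, ℂ)) := by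
      refine Summable.of_norm_bounded hc fun n => ?_
      rw [norm_smul, mFourier_norm, mul_one, norm_mul]
      exact mul_le_of_le_one_right (norm_nonneg _) (hn n)
    have e : ∑' n, c n * Λ (mFourier (-n)) * mFourier n y =
        Λ (∑' n, (c n * mFourier n y) • (mFourier (-n) : C(T2, ℂ))) := by
      rw [Λ.map_tsum hs]
      refine tsum_congr fun n => ?_
      rw [map_smul, smul_eq_mul]
      ring
    rw [e]
    refine Λ.le_opNorm_of_le ((ContinuousMap.norm_le _ hC0).2 fun x => ?_)
    rw [← ContinuousMap.tsum_apply hs]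
    refine le_trans (le_of_eq ?_) (hC (y + -x))
    congr 1
    refine tsum_congr fun n => ?_
    rw [mFourier_add_apply, ContinuousMap.smul_apply, mFourier_neg_apply, smul_eq_mul, mul_assoc]
  have hs : Summable fun n => conj (c n * Λ (mFourier (-n))) • (mFourier (-n) : C(T2, ℂ)) := by
    refine Summable.of_norm_bounded (hc.mul_right ‖Λ‖) fun n => ?_
    rw [norm_smul, mFourier_norm, mul_one, RCLike.norm_conj, norm_mul]
    gcongr
    exact hΛ _
  have hterm : ∀ n, c n * (Λ (mFourier (-n)) * conj (Γ (mFourier (-n)))) =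
      conj (Γ (conj (c n * Λ (mFourier (-n))) • (mFourier (-n) : C(T2, ℂ)))) := fun n => by
    rw [map_smul, smul_eq_mul, map_mul, Complex.conj_conj]
    ring
  simp only [hterm]
  refine ⟨Complex.conjCLE.summable.2 (Γ.summable hs), ?_⟩
  rw [← Complex.conj_tsum, RCLike.norm_conj, ← Γ.map_tsum hs]
  refine (Γ.le_opNorm_of_le (c := ‖Λ‖ * C)
    ((ContinuousMap.norm_le _ (by positivity)).2 fun y => ?_)).trans_eq (by ring)
  rw [← ContinuousMap.tsum_apply hs]
  refine le_trans (le_of_eq ?_) (hker y)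
  rw [← RCLike.norm_conj, Complex.conj_tsum]
  congr 1
  refine tsum_congr fun n => ?_
  rw [ContinuousMap.smul_apply, smul_eq_mul, map_mul, Complex.conj_conj, mFourier_neg, Complex.conj_conj]

/-! ### Measures and derivatives on the Fourier side -/

/-- Integration against a complex measure as a functional on the continuous functions. -/
def toDual (μ : ComplexMeasure T2) : C(T2, ℂ) →L[ℂ] ℂ :=
  LinearMap.mkContinuous
    { toFun := fun f => μ.integral f (ContinuousLinearMap.mul ℝ ℂ)
      map_add' := fun f g => VectorMeasure.integral_add
        (f.continuous.integrable_of_hasCompactSupport (HasCompactSupport.of_compactSpace _))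
        (g.continuous.integrable_of_hasCompactSupport (HasCompactSupport.of_compactSpace _))
      map_smul' := fun c f => by
        refine setToFun_smul (𝕜 := ℂ) _ (fun c s x => ?_) c (f : T2 → ℂ)
        change c • x * μ s = c • (x * μ s)
        rw [smul_mul_assoc] }
    (measureNorm μ) fun f => by
      refine (VectorMeasure.norm_integral_le_of_norm_le_const (μ := μ) (f := (f : T2 → ℂ))
        (B := ContinuousLinearMap.mul ℝ ℂ) (C := ‖f‖)
        (Filter.Eventually.of_forall fun x => f.norm_coe_le_norm x)).trans ?_
      have h : ‖ContinuousLinearMap.mul ℝ ℂ‖ ≤ 1 := ContinuousLinearMap.opNorm_mul_le ℝ ℂ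
      have h2 : 0 ≤ ‖f‖ * measureNorm μ := by unfold measureNorm; positivity
      change _ * measureNorm μ ≤ _
      nlinarith

theorem measureNorm_nonneg (μ : ComplexMeasure T2) : 0 ≤ measureNorm μ := ENNReal.toReal_nonneg

theorem norm_toDual_le (μ : ComplexMeasure T2) : ‖toDual μ‖ ≤ measureNorm μ :=
  LinearMap.mkContinuous_norm_le _ (measureNorm_nonneg μ) _

theorem fourierCoeff_ofMeasure (μ : ComplexMeasure T2) (n : Fin 2 → ℤ) :
    (ofMeasure μ).fourierCoeff n = toDual μ (mFourier (-n)) := rfl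

theorem pderiv_mFourier (i : Fin 2) (n : Fin 2 → ℤ) (z : T2) :
    pderiv i (fun z => mFourier n z) z = (2 * Real.pi * Complex.I * n i) * mFourier n z := by
  unfold pderiv
  have h : ∀ t : ℝ, mFourier n (z + Pi.single i (t : UnitAddCircle)) =
      mFourier n z * fourier (n i) (t : UnitAddCircle) := fun t => by
    rw [mFourier_add_apply]
    congr 1
    rw [mFourier, ContinuousMap.coe_mk,
      prod_eq_single i (fun j _ hj => by rw [Pi.single_eq_of_ne hj, fourier_eval_zero]) (by simp),
      Pi.single_eq_same]
  simp only [h]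
  have hd := ((hasDerivAt_fourier 1 (n i) 0).const_mul (mFourier n z)).deriv
  rw [AddCircle.coe_zero, fourier_eval_zero] at hd
  rw [hd]
  push_cast
  ring

theorem partialL_character (i : Fin 2) (n : Fin 2 → ℤ) : TestFunction.partialL i
    (TestFunction.character n) = (2 * Real.pi * Complex.I * n i) • TestFunction.character n :=
  TestFunction.ext fun z => pderiv_mFourier i n z

theorem fourierCoeff_pd (i : Fin 2) (u : Distr) (n : Fin 2 → ℤ) :
    (u.pd i).fourierCoeff n = (2 * Real.pi * Complex.I * n i) * u.fourierCoeff n := by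
  change -(u (TestFunction.partialL i (TestFunction.character (-n)))) = _
  rw [partialL_character, map_smul, Distr.fourierCoeff]
  simp

theorem fourierCoeff_iterate_pd (i : Fin 2) (k : ℕ) (u : Distr) (n : Fin 2 → ℤ) :
    ((Distr.pd i)^[k] u).fourierCoeff n =
      (2 * Real.pi * Complex.I * n i) ^ k * u.fourierCoeff n := by
  induction k with
  | zero => simp
  | succ k ih => rw [Function.iterate_succ_apply', fourierCoeff_pd, ih]; ring

/-! ### The generating polynomial of the system and the quadratic estimate -/

theorem exists_vandermonde_inverse {N : ℕ} {v : Fin N → ℂ} (hv : Function.Injective v) :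
    ∃ c : Fin N → Fin N → ℂ, ∀ (x : Fin N → ℂ) (j : Fin N),
      x j = ∑ r, c j r * ∑ i : Fin N, v r ^ (i : ℕ) * x i := by
  have hdet : IsUnit (Matrix.vandermonde v).det :=
    isUnit_iff_ne_zero.2 (Matrix.det_vandermonde_ne_zero_iff.2 hv)
  refine ⟨fun j r => (Matrix.vandermonde v)⁻¹ j r, fun x j => ?_⟩
  have h : (Matrix.vandermonde v)⁻¹.mulVec ((Matrix.vandermonde v).mulVec x) = x := by
    rw [Matrix.mulVec_mulVec, Matrix.nonsing_inv_mul _ hdet, Matrix.one_mulVec]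
  exact (congrFun h j).symm

/-- Each `f j` enters two consecutive equations, with coefficient `b` at `τ^j` and `-a` at
`τ^(j-1)`; collecting them gives the common factor `τ b - a`. -/
theorem sum_pow_mul_telescope {N : ℕ} (hN : 1 ≤ N) {a b : ℂ} {m f : ℕ → ℂ} (h0 : m 0 = -(a * f 1))
    (hj : ∀ j, 1 ≤ j → j < N → m j = b * f j - a * f (j + 1)) (hlast : m N = b * f N) (τ : ℂ) :
    ∑ j ∈ range (N + 1), τ ^ j * m j =
      (τ * b - a) * ∑ r : Fin N, τ ^ (r : ℕ) * f (r + 1) := by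
  rw [Fin.sum_univ_eq_sum_range (fun r => τ ^ r * f (r + 1)) N]
  obtain ⟨M, rfl⟩ : ∃ M, N = M + 1 := ⟨N - 1, by omega⟩
  rw [sum_range_succ, hlast, sum_range_succ', h0,
    sum_congr rfl fun j hjM => by rw [hj (j + 1) (by omega) (by have := mem_range.1 hjM; omega)],
    sub_mul]
  nth_rewrite 1 [sum_range_succ]
  nth_rewrite 1 [sum_range_succ']
  have e : ∑ j ∈ range M, τ ^ (j + 1) * (b * f (j + 1) - a * f (j + 1 + 1)) =
      τ * b * ∑ j ∈ range M, τ ^ j * f (j + 1) -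
        a * ∑ j ∈ range M, τ ^ (j + 1) * f (j + 1 + 1) := by
    rw [mul_sum, mul_sum, ← sum_sub_distrib]
    exact sum_congr rfl fun j _ => by ring
  rw [e]
  ring

/-- The weight `|m|ᵏ⁻¹ |n|ˡ⁻¹`. -/
def weight (k l : ℕ) (n : Fin 2 → ℤ) : ℝ := |(n 0 : ℝ)| ^ (k - 1) * |(n 1 : ℝ)| ^ (l - 1)

theorem weight_nonneg (k l : ℕ) (n : Fin 2 → ℤ) : 0 ≤ weight k l n := by unfold weight; positivity

theorem ofReal_sub_I_mul_mul_ne_zero {k l : ℕ} {p : ℝ} (hp : p ≠ 0) {n : Fin 2 → ℤ} {i : Fin 2}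
    (hn : n i ≠ 0) : (n 0 : ℂ) ^ k - Complex.I * p * (n 1 : ℂ) ^ l ≠ 0 := by
  intro h
  have hre := congrArg Complex.re h
  have him := congrArg Complex.im h
  have e : (n 0 : ℂ) ^ k - Complex.I * p * (n 1 : ℂ) ^ l =
      (((n 0 : ℝ) ^ k : ℝ) : ℂ) - Complex.I * ((p * (n 1 : ℝ) ^ l : ℝ) : ℂ) := by
    push_cast; ring
  rw [e] at hre him
  simp only [Complex.sub_re, Complex.ofReal_re, Complex.mul_re, Complex.I_re, zero_mul,
    Complex.I_im, Complex.ofReal_im, mul_zero, sub_zero, Complex.zero_re] at hre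
  simp only [Complex.sub_im, Complex.ofReal_im, Complex.mul_im, Complex.I_re, zero_mul,
    Complex.I_im, Complex.ofReal_re, one_mul, zero_sub, Complex.zero_im, zero_add,
    neg_eq_zero, mul_eq_zero, hp, false_or] at him
  have h0 : n 0 = 0 := by exact_mod_cast eq_zero_of_pow_eq_zero hre
  have h1 : n 1 = 0 := by exact_mod_cast eq_zero_of_pow_eq_zero him
  fin_cases i
  · exact hn h0
  · exact hn h1

/-- The generating polynomials of the families `Λ` and `f` are related by the symbol of the
operator `τ ∂₂ˡ - ∂₁ᵏ`. -/
def IsSystem (k l N : ℕ) (Λ : ℕ → C(T2, ℂ) →L[ℂ] ℂ) (f : ℕ → (Fin 2 → ℤ) → ℂ) : Prop :=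
  ∀ (τ : ℂ) (n : Fin 2 → ℤ), ∑ j ∈ range (N + 1), τ ^ j * Λ j (mFourier (-n)) =
    (τ * (2 * Real.pi * Complex.I * n 1) ^ l - (2 * Real.pi * Complex.I * n 0) ^ k) *
      ∑ r : Fin N, τ ^ (r : ℕ) * f (r + 1) n

theorem norm_sum_pow_smul_le (N : ℕ) (Λ : ℕ → C(T2, ℂ) →L[ℂ] ℂ) (τ : ℂ) :
    ‖∑ j ∈ range (N + 1), τ ^ j • Λ j‖ ≤ (1 + ‖τ‖) ^ N * ∑ j ∈ range (N + 1), ‖Λ j‖ := by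
  rw [mul_sum]
  refine (norm_sum_le (range (N + 1)) fun j => τ ^ j • Λ j).trans (sum_le_sum fun j hj => ?_)
  refine (ContinuousLinearMap.opNorm_smul_le _ _).trans ?_
  rw [norm_pow]
  refine mul_le_mul_of_nonneg_right ?_ (ContinuousLinearMap.opNorm_nonneg _)
  calc ‖τ‖ ^ j ≤ (1 + ‖τ‖) ^ j := by gcongr; linarith
    _ ≤ (1 + ‖τ‖) ^ N := pow_le_pow_right₀ (by linarith [norm_nonneg τ])
      (Nat.lt_succ_iff.1 (mem_range.1 hj))

/-- The ratio of the symbols of `∂₁ᵏ` and `∂₂ˡ` at the frequency `(1, 1)`. -/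
def symbolRatio (k l : ℕ) : ℂ := (2 * Real.pi * Complex.I) ^ k / (2 * Real.pi * Complex.I) ^ l

theorem symbolRatio_ne_zero (k l : ℕ) : symbolRatio k l ≠ 0 :=
  div_ne_zero (pow_ne_zero _ Complex.two_pi_I_ne_zero) (pow_ne_zero _ Complex.two_pi_I_ne_zero)

/-- Normalizing `τ` by the ratio removes the unequal powers of `2πi`; the choice `s = ip` then gives
the factor of `symbol`, whatever the parities of `k` and `l`. -/
theorem symbolRatio_mul_sub (k l : ℕ) (s : ℂ) (m n : ℤ) :
    symbolRatio k l * s * (2 * Real.pi * Complex.I * n) ^ l - (2 * Real.pi * Complex.I * m) ^ k =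
      -((2 * Real.pi * Complex.I) ^ k * ((m : ℂ) ^ k - s * (n : ℂ) ^ l)) := by
  have h := pow_ne_zero l Complex.two_pi_I_ne_zero
  unfold symbolRatio
  rw [mul_pow, mul_pow]
  field_simp
  ring

theorem exists_bilinear_bound {k l : ℕ} (hk : 1 ≤ k) (hl : 1 ≤ l) (hodd : Odd k ∨ Odd l) (N : ℕ) :
    ∃ i : Fin 2, ∀ p q : ℝ, 0 < p * q → p ≠ q → ∃ C : ℝ, 0 ≤ C ∧ ∀ S : Finset ℤ, 0 ∉ S →
      ∀ (Λ : ℕ → C(T2, ℂ) →L[ℂ] ℂ) (f : ℕ → (Fin 2 → ℤ) → ℂ), IsSystem k l N Λ f →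
        ∃ F : (Fin 2 → ℤ) → ℂ, (∀ n, n i ∈ S → F n = weight k l n *
            ((∑ r : Fin N, (symbolRatio k l * (Complex.I * p)) ^ (r : ℕ) * f (r + 1) n) *
            conj (∑ r : Fin N, (symbolRatio k l * -(Complex.I * q)) ^ (r : ℕ) * f (r + 1) n))) ∧
          (∀ n, n i ∉ S → F n = 0) ∧ Summable F ∧
          ‖∑' n, F n‖ ≤ C * (∑ j ∈ range (N + 1), ‖Λ j‖) ^ 2 := by
  obtain ⟨i, hi⟩ := exists_kernel_bound_torus hk hl hodd
  refine ⟨i, fun p q hpq hne => ?_⟩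
  have hp : p ≠ 0 := left_ne_zero_of_mul hpq.ne'
  have hq : q ≠ 0 := right_ne_zero_of_mul hpq.ne'
  obtain ⟨C, hC, h⟩ := hi p q hpq hne
  set τ := symbolRatio k l * (Complex.I * p) with hτ
  -- The minus sign is undone by the conjugation in the second factor, so that both factors of the
  -- symbol carry `-i` times a parameter of the same sign.
  set σ := symbolRatio k l * -(Complex.I * q) with hσ
  set P : ℂ := (2 * Real.pi * Complex.I) ^ k with hP
  have hP0 : P ≠ 0 := pow_ne_zero _ Complex.two_pi_I_ne_zero
  have hPc : conj P ≠ 0 := by simpa using hP0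
  refine ⟨‖(P * conj P)⁻¹‖ * (C * ((1 + ‖τ‖) ^ N * (1 + ‖σ‖) ^ N)), by positivity,
    fun S hS Λ f hsys => ?_⟩
  obtain ⟨h1, h2⟩ := h S hS
  set M := ∑ j ∈ range (N + 1), ‖Λ j‖ with hM
  have hM0 : 0 ≤ M := sum_nonneg fun _ _ => ContinuousLinearMap.opNorm_nonneg _
  obtain ⟨h3, h4⟩ := norm_tsum_mul_conj_le h1 hC h2 (∑ j ∈ range (N + 1), τ ^ j • Λ j)
    (∑ j ∈ range (N + 1), σ ^ j • Λ j)
  have hval : ∀ (ρ : ℂ) n, (∑ j ∈ range (N + 1), ρ ^ j • Λ j) (mFourier (-n)) =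
      (ρ * (2 * Real.pi * Complex.I * n 1) ^ l - (2 * Real.pi * Complex.I * n 0) ^ k) *
        ∑ r : Fin N, ρ ^ (r : ℕ) * f (r + 1) n := fun ρ n => by
    rw [← hsys ρ n, _root_.sum_apply]
    rfl
  refine ⟨_, fun n hn => ?_, fun n hn => ?_, h3.mul_left (P * conj P)⁻¹, ?_⟩
  · have hni : n i ≠ 0 := ne_of_mem_of_not_mem hn hS
    have ha := ofReal_sub_I_mul_mul_ne_zero (k := k) (l := l) hp hni
    have hb := ofReal_sub_I_mul_mul_ne_zero (k := k) (l := l) hq hni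
    rw [if_pos hn, hval, hval, hτ, symbolRatio_mul_sub, hσ, symbolRatio_mul_sub, ← hτ, ← hσ, ← hP]
    set A := ∑ r : Fin N, τ ^ (r : ℕ) * f (r + 1) n
    set B := ∑ r : Fin N, σ ^ (r : ℕ) * f (r + 1) n
    have hconj : conj (-(P * ((n 0 : ℂ) ^ k - -(Complex.I * q) * (n 1 : ℂ) ^ l)) * B) =
        -(conj P * ((n 0 : ℂ) ^ k - Complex.I * q * (n 1 : ℂ) ^ l)) * conj B := by
      simp only [map_mul, map_neg, map_sub, map_pow, Complex.conj_I, Complex.conj_ofReal,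
        map_intCast]
      ring
    rw [hconj]
    unfold symbol weight
    set U := (n 0 : ℂ) ^ k - Complex.I * p * (n 1 : ℂ) ^ l
    set V := (n 0 : ℂ) ^ k - Complex.I * q * (n 1 : ℂ) ^ l
    field_simp
  · rw [if_neg hn, zero_mul, mul_zero]
  · rw [tsum_mul_left, norm_mul, mul_assoc]
    gcongr
    refine h4.trans ?_
    have e1 := norm_sum_pow_smul_le N Λ τ
    have e2 := norm_sum_pow_smul_le N Λ σ
    calc _ ≤ C * (((1 + ‖τ‖) ^ N * M) * ((1 + ‖σ‖) ^ N * M)) := by gcongr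
      _ = _ := by ring

/-- Inverting one Vandermonde system for each factor writes `f_j * conj f_j` through the bilinear
expressions already bounded. The resulting summands are nonnegative, so the bound on the full sum
passes to every finite partial sum. -/
theorem exists_weighted_sum_bound {k l : ℕ} (hk : 1 ≤ k) (hl : 1 ≤ l) (hodd : Odd k ∨ Odd l)
    (N : ℕ) : ∃ i : Fin 2, ∃ C : ℝ, 0 ≤ C ∧
      ∀ (Λ : ℕ → C(T2, ℂ) →L[ℂ] ℂ) (f : ℕ → (Fin 2 → ℤ) → ℂ), IsSystem k l N Λ f →
        ∀ (j : Fin N) (s : Finset (Fin 2 → ℤ)), (∀ n ∈ s, n i ≠ 0) →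
          ∑ n ∈ s, weight k l n * ‖f (j + 1) n‖ ^ 2 ≤ C * (∑ j ∈ range (N + 1), ‖Λ j‖) ^ 2 := by
  obtain ⟨i, hi⟩ := exists_bilinear_bound hk hl hodd N
  -- The values of `p` are `1, …, N` and those of `q` are `N + 1, …, 2N`: all positive, and no `p`
  -- equals a `q`.
  have hpos : ∀ r r' : Fin N, 0 < ((r : ℝ) + 1) * ((r' : ℝ) + N + 1) := fun r r' => by positivity
  have hne : ∀ r r' : Fin N, (r : ℝ) + 1 ≠ (r' : ℝ) + N + 1 := fun r r' => by
    have h1 : ((r : ℕ) : ℝ) < N := by exact_mod_cast r.2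
    have h2 : (0 : ℝ) ≤ ((r' : ℕ) : ℝ) := Nat.cast_nonneg _
    intro h
    linarith
  choose C hC hbound using fun r r' => hi _ _ (hpos r r') (hne r r')
  obtain ⟨c, hc⟩ := exists_vandermonde_inverse (N := N)
    (v := fun r => symbolRatio k l * (Complex.I * ((r : ℝ) + 1 : ℝ))) (fun r r' h => by
      have h := mul_left_cancel₀ Complex.I_ne_zero (mul_left_cancel₀ (symbolRatio_ne_zero k l) h)
      rw [Complex.ofReal_inj] at h
      exact Fin.ext (by exact_mod_cast add_right_cancel h))
  obtain ⟨d, hd⟩ := exists_vandermonde_inverse (N := N)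
    (v := fun r => symbolRatio k l * -(Complex.I * ((r : ℝ) + N + 1 : ℝ))) (fun r r' h => by
      have h := mul_left_cancel₀ Complex.I_ne_zero
        (neg_injective (mul_left_cancel₀ (symbolRatio_ne_zero k l) h))
      rw [Complex.ofReal_inj] at h
      exact Fin.ext (by exact_mod_cast add_right_cancel (add_right_cancel h)))
  refine ⟨i, ∑ j, ∑ r, ∑ r', ‖c j r * conj (d j r')‖ * C r r',
    sum_nonneg fun j _ => sum_nonneg fun r _ => sum_nonneg fun r' _ =>
      mul_nonneg (norm_nonneg _) (hC r r'), fun Λ f hsys j s hs => ?_⟩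
  set M := ∑ j ∈ range (N + 1), ‖Λ j‖ with hM
  -- The truncation set consists of the `i`-th coordinates occurring in `s`; the bound does not
  -- depend on it.
  choose F hF hF0 hFs hFb using fun r r' =>
    hbound r r' (s.image fun n => n i) (by simpa using hs) Λ f hsys
  set G : (Fin 2 → ℤ) → ℂ := fun n => ∑ r, ∑ r', c j r * conj (d j r') * F r r' n with hG
  have hGs : Summable G := summable_sum fun r _ => summable_sum fun r' _ => (hFs r r').mul_left _
  have hGval : ∀ n, n i ∈ s.image (fun n => n i) →
      G n = ((weight k l n * ‖f (j + 1) n‖ ^ 2 : ℝ) : ℂ) := fun n hn => by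
    have e1 := hc (fun r => f (r + 1) n) j
    have e2 := hd (fun r => f (r + 1) n) j
    have e3 : ((weight k l n * ‖f (j + 1) n‖ ^ 2 : ℝ) : ℂ) =
        weight k l n * (f (j + 1) n * conj (f (j + 1) n)) := by
      rw [Complex.mul_conj, Complex.normSq_eq_norm_sq]
      push_cast
      ring
    rw [e3]
    nth_rewrite 1 [e1]
    rw [e2, map_sum, sum_mul_sum, mul_sum, hG]
    refine sum_congr rfl fun r _ => ?_
    rw [mul_sum]
    refine sum_congr rfl fun r' _ => ?_
    rw [hF r r' n hn, map_mul]
    ring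
  have hGre : ∀ n, 0 ≤ (G n).re := fun n => by
    by_cases hn : n i ∈ s.image (fun n => n i)
    · rw [hGval n hn, Complex.ofReal_re]
      exact mul_nonneg (weight_nonneg k l n) (by positivity)
    · have : G n = 0 := sum_eq_zero fun r _ => sum_eq_zero fun r' _ => by
        rw [hF0 r r' n hn, mul_zero]
      simp [this]
  have hGb : ‖∑' n, G n‖ ≤ (∑ r, ∑ r', ‖c j r * conj (d j r')‖ * C r r') * M ^ 2 := by
    rw [hG, Summable.tsum_finsetSum fun r _ => summable_sum fun r' _ => (hFs r r').mul_left _,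
      sum_mul]
    refine norm_sum_le_of_le _ fun r _ => ?_
    rw [Summable.tsum_finsetSum fun r' _ => (hFs r r').mul_left _, sum_mul]
    refine norm_sum_le_of_le _ fun r' _ => ?_
    rw [tsum_mul_left, norm_mul, mul_assoc]
    gcongr
    exact hFb r r'
  have hGr := Complex.hasSum_re hGs.hasSum
  calc ∑ n ∈ s, weight k l n * ‖f (j + 1) n‖ ^ 2 = ∑ n ∈ s, (G n).re :=
        sum_congr rfl fun n hn => by
          rw [hGval n (mem_image_of_mem _ hn), Complex.ofReal_re]
    _ ≤ (∑' n, G n).re := sum_le_hasSum s (fun n _ => hGre n) hGr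
    _ ≤ ‖∑' n, G n‖ := Complex.re_le_norm _
    _ ≤ (∑ r, ∑ r', ‖c j r * conj (d j r')‖ * C r r') * M ^ 2 := hGb
    _ ≤ _ := by
      refine mul_le_mul_of_nonneg_right ?_ (sq_nonneg M)
      exact single_le_sum (f := fun j => ∑ r, ∑ r', ‖c j r * conj (d j r')‖ * C r r')
        (fun j _ => sum_nonneg fun r _ => sum_nonneg fun r' _ =>
          mul_nonneg (norm_nonneg _) (hC r r')) (mem_univ j)

/-! ### Comparison with the Sobolev weights -/

/-- Away from zero `1 + m² ≤ (2|m|)²`. The exponent is the Sobolev order `(k-1)/2`, halved as in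
`sobolevCoeff`. -/
theorem sq_rpow_le (k : ℕ) (hk : 1 ≤ k) {m : ℤ} (hm : m ≠ 0) :
    ((1 + (m : ℝ) ^ 2) ^ (((k : ℝ) - 1) / 2 / 2)) ^ 2 ≤ 2 ^ (k - 1) * |(m : ℝ)| ^ (k - 1) := by
  have h1 : (1 : ℝ) ≤ |(m : ℝ)| := by exact_mod_cast Int.one_le_abs hm
  have h2 : 1 + (m : ℝ) ^ 2 ≤ (2 * |(m : ℝ)|) ^ 2 := by
    rw [← sq_abs]; nlinarith
  have hk' : (0 : ℝ) ≤ (k : ℝ) - 1 := by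
    have : (1 : ℝ) ≤ k := by exact_mod_cast hk
    linarith
  rw [← Real.rpow_mul_natCast (by positivity), ← mul_pow]
  calc (1 + (m : ℝ) ^ 2) ^ (((k : ℝ) - 1) / 2 / 2 * (2 : ℕ))
      ≤ ((2 * |(m : ℝ)|) ^ 2) ^ (((k : ℝ) - 1) / 2 / 2 * (2 : ℕ)) := by gcongr
    _ = (2 * |(m : ℝ)|) ^ (((k - 1 : ℕ)) : ℝ) := by
      rw [← Real.rpow_natCast_mul (by positivity)]
      congr 1
      push_cast [hk]
      ring
    _ = _ := Real.rpow_natCast _ _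

theorem norm_sobolevCoeff_sq_le {k l : ℕ} (hk : 1 ≤ k) (hl : 1 ≤ l) (u : Distr) {n : Fin 2 → ℤ}
    (h0 : n 0 ≠ 0) (h1 : n 1 ≠ 0) :
    ‖u.sobolevCoeff (((k : ℝ) - 1) / 2) (((l : ℝ) - 1) / 2) n‖ ^ 2 ≤
      2 ^ (k - 1) * 2 ^ (l - 1) * (weight k l n * ‖u.fourierCoeff n‖ ^ 2) := by
  unfold Distr.sobolevCoeff weight
  rw [norm_mul, Complex.norm_real, Real.norm_of_nonneg (by positivity), mul_pow, mul_pow]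
  calc _ ≤ ((2 ^ (k - 1) * |(n 0 : ℝ)| ^ (k - 1)) * (2 ^ (l - 1) * |(n 1 : ℝ)| ^ (l - 1))) *
        ‖u.fourierCoeff n‖ ^ 2 := by
        gcongr
        · exact sq_rpow_le k hk h0
        · exact sq_rpow_le l hl h1
    _ = _ := by ring

theorem memSobolev_and_sobolevNorm_le {α β B : ℝ} {u : Distr} (hB : 0 ≤ B)
    (h : ∀ s : Finset (Fin 2 → ℤ), ∑ n ∈ s, ‖u.sobolevCoeff α β n‖ ^ 2 ≤ B ^ 2) :
    u.MemSobolev α β ∧ u.sobolevNorm α β ≤ B := by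
  have hs : Summable fun n => ‖u.sobolevCoeff α β n‖ ^ 2 :=
    summable_of_sum_le (fun n => by positivity) h
  refine ⟨memℓp_gen (hs.congr fun n => by simp), Real.sqrt_le_iff.2 ⟨hB, ?_⟩⟩
  exact hs.tsum_le_of_sum_le h

end Torus

end

/-! ### The theorem -/

theorem theorem2 (k l N : ℕ) (hk : 1 ≤ k) (hl : 1 ≤ l) (hN : 1 ≤ N) (hodd : Odd k ∨ Odd l) :
    ∃ C : ℝ, ∀ (φ : ℕ → Torus.Distr) (μ : ℕ → MeasureTheory.ComplexMeasure Torus.T2),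
      (∀ j, 1 ≤ j → j ≤ N → (φ j).IsProper) →
      -((Torus.Distr.pd 0)^[k] (φ 1)) = Torus.ofMeasure (μ 0) →
      (∀ j, 1 ≤ j → j < N →
        (Torus.Distr.pd 1)^[l] (φ j) - (Torus.Distr.pd 0)^[k] (φ (j + 1)) =
          Torus.ofMeasure (μ j)) →
      (Torus.Distr.pd 1)^[l] (φ N) = Torus.ofMeasure (μ N) →
      (∀ j, 1 ≤ j → j ≤ N →
        (φ j).MemSobolev (((k : ℝ) - 1) / 2) (((l : ℝ) - 1) / 2)) ∧
      ∑ j ∈ Finset.Icc 1 N, (φ j).sobolevNorm (((k : ℝ) - 1) / 2) (((l : ℝ) - 1) / 2) ≤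
        C * ∑ j ∈ Finset.range (N + 1), Torus.measureNorm (μ j) := by
  obtain ⟨i, C, hC, h⟩ := Torus.exists_weighted_sum_bound hk hl hodd N
  set K : ℝ := 2 ^ (k - 1) * 2 ^ (l - 1) * C with hK
  have hK0 : 0 ≤ K := by positivity
  refine ⟨N * √K, fun φ μ hproper h0 hmid hlast => ?_⟩
  set M := ∑ j ∈ Finset.range (N + 1), Torus.measureNorm (μ j) with hM
  have hM0 : 0 ≤ M := Finset.sum_nonneg fun j _ => Torus.measureNorm_nonneg _
  have hsys : Torus.IsSystem k l N (fun j => Torus.toDual (μ j))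
      (fun j n => (φ j).fourierCoeff n) := fun τ n => by
    refine Torus.sum_pow_mul_telescope hN (f := fun j => (φ j).fourierCoeff n)
      (m := fun j => Torus.toDual (μ j) (UnitAddTorus.mFourier (-n))) ?_ (fun j h1 h2 => ?_) ?_ τ
    · rw [← Torus.fourierCoeff_ofMeasure, ← h0, ← Torus.fourierCoeff_iterate_pd]
      rfl
    · rw [← Torus.fourierCoeff_ofMeasure, ← hmid j h1 h2, ← Torus.fourierCoeff_iterate_pd,
        ← Torus.fourierCoeff_iterate_pd]
      rfl
    · rw [← Torus.fourierCoeff_ofMeasure, ← hlast, ← Torus.fourierCoeff_iterate_pd]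
  have hmain : ∀ j, 1 ≤ j → j ≤ N →
      (φ j).MemSobolev (((k : ℝ) - 1) / 2) (((l : ℝ) - 1) / 2) ∧
      (φ j).sobolevNorm (((k : ℝ) - 1) / 2) (((l : ℝ) - 1) / 2) ≤ √K * M := by
    intro j h1 h2
    refine Torus.memSobolev_and_sobolevNorm_le (by positivity) fun s => ?_
    have hsum := h _ _ hsys ⟨j - 1, by omega⟩ (s.filter fun n => n 0 ≠ 0 ∧ n 1 ≠ 0) fun n hn => by
      have := (Finset.mem_filter.1 hn).2
      fin_cases i
      · exact this.1
      · exact this.2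
    simp only [Nat.sub_add_cancel h1] at hsum
    have hΛ : ∑ j ∈ Finset.range (N + 1), ‖Torus.toDual (μ j)‖ ≤ M :=
      Finset.sum_le_sum fun j _ => Torus.norm_toDual_le _
    -- Properness removes the frequencies on the axes, which the quadratic estimate does not
    -- control.
    rw [← Finset.sum_filter_of_ne (p := fun n => n 0 ≠ 0 ∧ n 1 ≠ 0) fun n _ hn => by
      by_contra hcon
      refine hn ?_
      have := hproper j h1 h2 n (by tauto)
      simp [Torus.Distr.sobolevCoeff, this]]
    calc _ ≤ ∑ n ∈ s.filter (fun n => n 0 ≠ 0 ∧ n 1 ≠ 0), 2 ^ (k - 1) * 2 ^ (l - 1) *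
          (Torus.weight k l n * ‖(φ j).fourierCoeff n‖ ^ 2) :=
          Finset.sum_le_sum fun n hn =>
            Torus.norm_sobolevCoeff_sq_le hk hl _ (Finset.mem_filter.1 hn).2.1
              (Finset.mem_filter.1 hn).2.2
      _ ≤ 2 ^ (k - 1) * 2 ^ (l - 1) * (C * M ^ 2) := by
        rw [← Finset.mul_sum]
        gcongr
        refine hsum.trans ?_
        gcongr
      _ = _ := by rw [mul_pow, Real.sq_sqrt hK0, hK]; ring
  refine ⟨fun j h1 h2 => (hmain j h1 h2).1, ?_⟩
  refine (Finset.sum_le_card_nsmul _ _ (√K * M) fun j hj =>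
    (hmain j (Finset.mem_Icc.1 hj).1 (Finset.mem_Icc.1 hj).2).2).trans_eq ?_
  rw [Nat.card_Icc, nsmul_eq_mul, Nat.add_sub_cancel, mul_assoc]
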